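/- Let $U\subset\mathbb{R}^n$ be open with standard coordinates $y^1,\dots,y^n$, let $V=V^i\partial_{y^i}$ be a smooth vector field on $U$, and let $P$ be the pseudogroup of local diffeomorphisms of $U$ generated by the local flow of $V$; write $U/V$ for the quotient $U/P$. Let $B(U)=U\times(\mathbb{R}^n)^*$ with coordinates $y^i,y_i$. A local diffeomorphism $y\mapsto\alpha(y)$ of $U$ acts on $B(U)$ by $y^i\mapsto \alpha^i$ and $$y_k\mapsto\alpha_k=\frac{\partial y^p}{\partial \alpha^j}\frac{\partial^2 \alpha^j}{\partial y^p\partial y^q}\frac{\partial y^q}{\partial \alpha^k}+\frac{\partial y^j}{\partial \alpha^k}y_j .$$ Let $H^2(B(U/V))$ be the second cohomology of the complex of smooth differential forms on $B(U)$ invariant under the induced action of $P$. The form $dy_i\wedge dy^i$ is closed and invariant, and its class in $H^2(B(U/V))$ is the first Chern–Losik class of $U/V$. The induced vector field on $B(U)$ is $$\tilde V=V^i\frac{\partial}{\partial y^i}+\Big(\frac{\partial^2 V^j}{\partial y^j\partial y^i}-\frac{\partial V^j}{\partial y^i}y_j\Big)\frac{\partial}{\partial y_i}.$$ **Theorem.**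 Let $f:(-1,1)\to\mathbb{R}$ be a smooth even function that does not vanish on $(0,1)$, let $D^2\subset\mathbb{R}^2$ be the open unit disc, let $r=\sqrt{(y^1)^2+(y^2)^2}$, and let $V$ be the vector field on $D^2$ with components $V^1=f(r)y^1$, $V^2=f(r)y^2$. Then the first Chern–Losik class of $D^2/V$ is non-trivial in $H^2(B(D^2/V))$ if and only if $f(0)=0$. Moreover, consider, for a constant $R\in\mathbb{R}$, the equation $$\tilde V G=-\frac{\partial V^1}{\partial y^1}-\frac{\partial V^2}{\partial y^2}+R\qquad(\ast)$$ for a smooth function $G$ on $B(D^2)=D^2\times\mathbb{R}^2$. 1. If $f(0)\neq 0$, then for every $r_0\in(0,1)$ the function $$G_0(r)=-\int_{r_0}^{r}\frac{2f(\rho)+f'(\rho)\rho-2f(0)}{f(\rho)\rho}\,d\rho$$ on $D^2\setminus\{0\}$ extends to a smooth function on $D^2$, and this extension (viewed as a function on $B(D^2)$ not depending on $y_1,y_2$) is a solution of $(\ast)$ with $R=2f(0)$. 2. If $f(0)=0$, then $(\ast)$ has no smooth solution on $B(D^2)$ for any $R\in\mathbb{R}$. -/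

import Mathlib

open Set Topology
open scoped Manifold ContDiff

noncomputable section

namespace CL

/-- Euclidean space `ℝⁿ`. -/
abbrev E (n : ℕ) : Type := EuclideanSpace ℝ (Fin n)

/-- The model `ℝⁿ × (ℝⁿ)*` of the bundle `B`. A point is a pair `(y, p)`; the fibre coordinates
`y_i` are the components of the covector `p = y_i dy^i`. -/
abbrev BModel (n : ℕ) : Type := E n × (E n →L[ℝ] ℝ)

/-- `B(U) = U × (ℝⁿ)*` for an open subset `U` of `ℝⁿ`. -/
def B {n : ℕ} (U : TopologicalSpace.Opens (E n)) : TopologicalSpace.Opens (BModel n) :=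
  ⟨{z | z.1 ∈ U}, U.isOpen.preimage continuous_fst⟩

/-- The trace of an endomorphism of `ℝⁿ`, as a continuous linear functional. -/
def tr (n : ℕ) : (E n →L[ℝ] E n) →L[ℝ] ℝ :=
  LinearMap.toContinuousLinearMap
    ((LinearMap.trace ℝ (E n)) ∘ₗ (ContinuousLinearMap.coeLM ℝ))

/-- For a local diffeomorphism `α` of `ℝⁿ`, the covector at `y` with components
`(∂y^p/∂α^j) (∂²α^j/∂y^p∂y^q)`, i.e. `v ↦ tr (D(α⁻¹)(α y) ∘ D²α(y)(v, ·))`. -/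
def theta {n : ℕ} (α : OpenPartialHomeomorph (E n) (E n)) (y : E n) : E n →L[ℝ] ℝ :=
  (tr n) ∘L (ContinuousLinearMap.compL ℝ (E n) (E n) (E n) (fderiv ℝ α.symm (α y))) ∘L
    (fderiv ℝ (fderiv ℝ α) y)

/-- The map induced by a local diffeomorphism `α` on the bundle `B`. In coordinates
`α_k = (∂y^p/∂α^j)(∂²α^j/∂y^p∂y^q)(∂y^q/∂α^k) + (∂y^j/∂α^k) y_j`. -/
def lift {n : ℕ} (α : OpenPartialHomeomorph (E n) (E n)) (z : BModel n) : BModel n :=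
  (α z.1, (theta α z.1 + z.2) ∘L fderiv ℝ α.symm (α z.1))

/-- `φ` is (a restriction of) the time-`t` map of the local flow of the vector field `V` on `U`. -/
def IsFlowMap {n : ℕ} (U : TopologicalSpace.Opens (E n)) (V : E n → E n) (t : ℝ)
    (φ : OpenPartialHomeomorph (E n) (E n)) : Prop :=
  ∀ y ∈ φ.source, ∃ γ : ℝ → E n, γ 0 = y ∧ γ t = φ y ∧
    (∀ s ∈ uIcc 0 t, γ s ∈ U) ∧ IsIntegralCurveOn γ (fun _ => V) (uIcc 0 t)

/-- The pseudogroup of local diffeomorphisms generated by the local flow of `V` on `U`: the smallest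
pseudogroup containing all (restrictions of) flow maps. Its members whose source lies in `U` form
the pseudogroup of local diffeomorphisms of `U`; those generators with `t = 0` are the identity maps
of open subsets of `U`. -/
def flowPseudogroup {n : ℕ} (U : TopologicalSpace.Opens (E n)) (V : E n → E n) :
    StructureGroupoid (E n) :=
  sInf {P | ∀ φ ∈ contDiffGroupoid ∞ 𝓘(ℝ, E n), ∀ t : ℝ, IsFlowMap U V t φ → φ ∈ P}

section DeRham

variable {W : Type} [NormedAddCommGroup W] [NormedSpace ℝ W]

/-- Smooth `k`-forms on the open subset `S` of `W` that are invariant under every local map in `Γ`;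
a pair `(D, ψ) ∈ Γ` stands for the map `ψ` with domain `D`. Forms are represented by functions
on the whole of `W`; only their values on `S` matter. -/
def invForms (S : TopologicalSpace.Opens W) (Γ : Set (Set W × (W → W))) (k : ℕ) :
    Submodule ℝ (W → W [⋀^Fin k]→L[ℝ] ℝ) where
  carrier := {ξ | ContDiffOn ℝ ∞ ξ S ∧ ∀ γ ∈ Γ, ∀ z ∈ γ.1,
    (ξ (γ.2 z)).compContinuousLinearMap (fderiv ℝ γ.2 z) = ξ z}
  add_mem' := by
    rintro a b ⟨ha, ha'⟩ ⟨hb, hb'⟩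
    refine ⟨ha.add hb, fun γ hγ z hz => ?_⟩
    rw [Pi.add_apply, Pi.add_apply, ← ha' γ hγ z hz, ← hb' γ hγ z hz]
    rfl
  zero_mem' := ⟨contDiffOn_const, fun γ hγ z hz => rfl⟩
  smul_mem' := by
    rintro c a ⟨ha, ha'⟩
    refine ⟨contDiffOn_const.smul ha, fun γ hγ z hz => ?_⟩
    rw [Pi.smul_apply, Pi.smul_apply, ← ha' γ hγ z hz]
    rfl

theorem invForms_differentiableAt {S : TopologicalSpace.Opens W} {Γ : Set (Set W × (W → W))}
    {k : ℕ} {ξ : W → W [⋀^Fin k]→L[ℝ] ℝ} (hξ : ξ ∈ invForms S Γ k) {z : W} (hz : z ∈ S) :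
    DifferentiableAt ℝ ξ z :=
  (hξ.1.contDiffAt (S.isOpen.mem_nhds hz)).differentiableAt (by simp)

/-- The closed invariant `k`-forms. -/
def closedForms (S : TopologicalSpace.Opens W) (Γ : Set (Set W × (W → W))) (k : ℕ) :
    Submodule ℝ (W → W [⋀^Fin k]→L[ℝ] ℝ) where
  carrier := {ξ | ξ ∈ invForms S Γ k ∧ ∀ z ∈ S, extDeriv ξ z = 0}
  add_mem' := by
    rintro a b ⟨ha', ha⟩ ⟨hb', hb⟩
    refine ⟨add_mem ha' hb', fun z hz => ?_⟩
    rw [extDeriv_add (invForms_differentiableAt ha' hz) (invForms_differentiableAt hb' hz),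
      ha z hz, hb z hz, add_zero]
  zero_mem' := by
    refine ⟨zero_mem _, fun z hz => ?_⟩
    have := extDeriv_smul (0 : ℝ) (0 : W → W [⋀^Fin k]→L[ℝ] ℝ) (x := z)
    rw [zero_smul, zero_smul] at this
    exact this
  smul_mem' := by
    rintro c a ⟨ha', ha⟩
    refine ⟨Submodule.smul_mem _ c ha', fun z hz => ?_⟩
    rw [extDeriv_smul, ha z hz, smul_zero]

/-- Mathlib's instance, spelled out to help type class inference. -/
instance closedForms.addCommGroup (S : TopologicalSpace.Opens W) (Γ : Set (Set W × (W → W)))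
    (k : ℕ) : AddCommGroup (closedForms S Γ k) := Submodule.addCommGroup (closedForms S Γ k)

/-- The closed invariant `(k + 1)`-forms that are equal on `S` to `dη` for an invariant
`k`-form `η`. -/
def exactForms (S : TopologicalSpace.Opens W) (Γ : Set (Set W × (W → W))) (k : ℕ) :
    Submodule ℝ (closedForms S Γ (k + 1)) where
  carrier := {ξ | ∃ η ∈ invForms S Γ k, ∀ z ∈ S, extDeriv η z = ξ.1 z}
  add_mem' := by
    rintro a b ⟨α, hα, ha⟩ ⟨β, hβ, hb⟩
    refine ⟨α + β, add_mem hα hβ, fun z hz => ?_⟩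
    rw [extDeriv_add (invForms_differentiableAt hα hz) (invForms_differentiableAt hβ hz),
      ha z hz, hb z hz]
    rfl
  zero_mem' := ⟨0, zero_mem _, fun z hz => (closedForms S Γ k).zero_mem.2 z hz⟩
  smul_mem' := by
    rintro c a ⟨α, hα, ha⟩
    refine ⟨c • α, Submodule.smul_mem _ c hα, fun z hz => ?_⟩
    rw [extDeriv_smul, ha z hz]
    rfl

/-- The de Rham cohomology in degree `k + 1` of the complex of invariant forms:
closed forms modulo exterior derivatives of invariant forms. -/
abbrev deRham (S : TopologicalSpace.Opens W) (Γ : Set (Set W × (W → W))) (k : ℕ) : Type :=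
  closedForms S Γ (k + 1) ⧸ exactForms S Γ k

end DeRham

/-- The maps induced on `B` by the members of the pseudogroup `P` of local diffeomorphisms of `U`,
with their domains. -/
def liftedMaps {n : ℕ} (U : TopologicalSpace.Opens (E n)) (P : StructureGroupoid (E n)) :
    Set (Set (BModel n) × (BModel n → BModel n)) :=
  {γ | ∃ α ∈ P, α.source ⊆ U ∧ γ = ({z | z.1 ∈ α.source}, lift α)}

/-- `H²(B(U/V))`: the second de Rham cohomology of the complex of smooth forms on `B(U)` that are
invariant under the pseudogroup generated by the local flow of `V`. -/
abbrev H2B {n : ℕ} (U : TopologicalSpace.Opens (E n)) (V : E n → E n) : Type :=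
  deRham (B U) (liftedMaps U (flowPseudogroup U V)) 1

/-- The value `dy_i ∧ dy^i` of the symplectic form of `B` at each point: on tangent vectors
`(a, b)`, `(a', b')` with `a, a' ∈ ℝⁿ` and `b, b' ∈ (ℝⁿ)*` it is `b_i a'^i - b'_i a^i`. -/
def symplectic (n : ℕ) : BModel n [⋀^Fin 2]→L[ℝ] ℝ where
  toFun v := (v 0).2 (v 1).1 - (v 1).2 (v 0).1
  map_update_add' := by
    intro _ m i x y
    fin_cases i
    · simp [Function.update]; ring
    · simp [Function.update]; ring
  map_update_smul' := by
    intro _ m i c x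
    fin_cases i
    · simp [Function.update]; ring
    · simp [Function.update]; ring
  map_eq_zero_of_eq' := by
    intro v i j h hij
    have : v 0 = v 1 := by
      fin_cases i <;> fin_cases j <;> simp_all
    simp [this]
  cont := by fun_prop

theorem symplectic_apply {n : ℕ} (v : Fin 2 → BModel n) :
    symplectic n v = (v 0).2 (v 1).1 - (v 1).2 (v 0).1 := rfl

theorem tr_mul_comm {n : ℕ} (S T : E n →L[ℝ] E n) : tr n (S ∘L T) = tr n (T ∘L S) :=
  LinearMap.trace_mul_comm ℝ (S : E n →ₗ[ℝ] E n) (T : E n →ₗ[ℝ] E n)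

theorem contDiffOn_of_mem {n : ℕ} {α : OpenPartialHomeomorph (E n) (E n)}
    (hα : α ∈ contDiffGroupoid ∞ 𝓘(ℝ, E n)) :
    ContDiffOn ℝ ∞ α α.source ∧ ContDiffOn ℝ ∞ α.symm α.target := by
  rw [contDiffGroupoid, mem_groupoid_of_pregroupoid] at hα
  simpa [contDiffPregroupoid] using hα

section Invariance

variable {n : ℕ} {α : OpenPartialHomeomorph (E n) (E n)}

/-- The derivative of the inverse map, at the image point. -/
def invDeriv {n : ℕ} (α : OpenPartialHomeomorph (E n) (E n)) (y : E n) : E n →L[ℝ] E n :=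
  fderiv ℝ α.symm (α y)

theorem contDiffAt_of_mem (hα : α ∈ contDiffGroupoid ∞ 𝓘(ℝ, E n)) {y : E n}
    (hy : y ∈ α.source) : ContDiffAt ℝ ∞ α y :=
  (contDiffOn_of_mem hα).1.contDiffAt (α.open_source.mem_nhds hy)

theorem contDiffAt_symm_of_mem (hα : α ∈ contDiffGroupoid ∞ 𝓘(ℝ, E n)) {y : E n}
    (hy : y ∈ α.source) : ContDiffAt ℝ ∞ α.symm (α y) :=
  (contDiffOn_of_mem hα).2.contDiffAt (α.open_target.mem_nhds (α.map_source hy))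

theorem contDiffAt_fderiv (hα : α ∈ contDiffGroupoid ∞ 𝓘(ℝ, E n)) {y : E n}
    (hy : y ∈ α.source) : ContDiffAt ℝ ∞ (fderiv ℝ α) y :=
  (contDiffAt_of_mem hα hy).fderiv_right (by simp)

theorem contDiffAt_invDeriv (hα : α ∈ contDiffGroupoid ∞ 𝓘(ℝ, E n)) {y : E n}
    (hy : y ∈ α.source) : ContDiffAt ℝ ∞ (invDeriv α) y :=
  ContDiffAt.comp (g := fderiv ℝ α.symm) y
    ((contDiffAt_symm_of_mem hα hy).fderiv_right (m := ∞) (by simp)) (contDiffAt_of_mem hα hy)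

theorem invDeriv_comp (hα : α ∈ contDiffGroupoid ∞ 𝓘(ℝ, E n)) {y : E n} (hy : y ∈ α.source) :
    invDeriv α y ∘L fderiv ℝ α y = ContinuousLinearMap.id ℝ (E n) := by
  have h1 : fderiv ℝ (α.symm ∘ α) y = invDeriv α y ∘L fderiv ℝ α y :=
    fderiv_comp y ((contDiffAt_symm_of_mem hα hy).differentiableAt (by simp))
      ((contDiffAt_of_mem hα hy).differentiableAt (by simp))
  rw [← h1, ← fderiv_id (𝕜 := ℝ) (x := y)]
  apply Filter.EventuallyEq.fderiv_eq
  filter_upwards [α.open_source.mem_nhds hy] with w hw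
  simp [α.left_inv hw]

theorem comp_invDeriv (hα : α ∈ contDiffGroupoid ∞ 𝓘(ℝ, E n)) {y : E n} (hy : y ∈ α.source) :
    fderiv ℝ α y ∘L invDeriv α y = ContinuousLinearMap.id ℝ (E n) := by
  have h := congrArg (fun L : E n →L[ℝ] E n => (L : E n →ₗ[ℝ] E n)) (invDeriv_comp hα hy)
  have h3 : (fderiv ℝ α y : E n →ₗ[ℝ] E n) ∘ₗ (invDeriv α y : E n →ₗ[ℝ] E n) = LinearMap.id :=
    (LinearMap.comp_eq_id_comm ℝ (E n)).mp h
  ext1 v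
  exact congrArg (fun L : E n →ₗ[ℝ] E n => L v) h3

theorem fderiv_invDeriv (hα : α ∈ contDiffGroupoid ∞ 𝓘(ℝ, E n)) {y : E n} (hy : y ∈ α.source)
    (c : E n) : fderiv ℝ (invDeriv α) y c =
      -(invDeriv α y ∘L fderiv ℝ (fderiv ℝ α) y c ∘L invDeriv α y) := by
  have hAd := ((contDiffAt_fderiv hα hy).differentiableAt (by simp)).hasFDerivAt
  have hCd := ((contDiffAt_invDeriv hα hy).differentiableAt (by simp)).hasFDerivAt
  have h1 := hCd.clm_comp hAd
  have h2 : HasFDerivAt (fun w => invDeriv α w ∘L fderiv ℝ α w)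
      (0 : E n →L[ℝ] E n →L[ℝ] E n) y := by
    refine (hasFDerivAt_const (ContinuousLinearMap.id ℝ (E n)) y).congr_of_eventuallyEq ?_
    filter_upwards [α.open_source.mem_nhds hy] with w hw using invDeriv_comp hα hw
  have h3 : invDeriv α y ∘L fderiv ℝ (fderiv ℝ α) y c +
      fderiv ℝ (invDeriv α) y c ∘L fderiv ℝ α y = 0 :=
    congrArg (fun L : E n →L[ℝ] E n →L[ℝ] E n => L c) (h1.unique h2)
  have h4 := congrArg (fun L : E n →L[ℝ] E n => L ∘L invDeriv α y) h3
  simp only [ContinuousLinearMap.add_comp, ContinuousLinearMap.zero_comp,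
    ContinuousLinearMap.comp_assoc, comp_invDeriv hα hy, ContinuousLinearMap.comp_id] at h4
  rw [eq_neg_iff_add_eq_zero, add_comm]
  exact h4

theorem theta_apply (w a : E n) :
    theta α w a = tr n (invDeriv α w ∘L fderiv ℝ (fderiv ℝ α) w a) := rfl

theorem differentiableAt_theta (hα : α ∈ contDiffGroupoid ∞ 𝓘(ℝ, E n)) {y : E n}
    (hy : y ∈ α.source) : DifferentiableAt ℝ (theta α) y := by
  have h1 : DifferentiableAt ℝ (invDeriv α) y :=
    (contDiffAt_invDeriv hα hy).differentiableAt (by simp)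
  have h2 : DifferentiableAt ℝ (fderiv ℝ (fderiv ℝ α)) y :=
    ((contDiffAt_fderiv hα hy).fderiv_right (m := ∞) (by simp)).differentiableAt (by simp)
  have h3 : DifferentiableAt ℝ
      (fun w => ContinuousLinearMap.compL ℝ (E n) (E n) (E n) (invDeriv α w)) y :=
    DifferentiableAt.comp y (g := ContinuousLinearMap.compL ℝ (E n) (E n) (E n))
      (ContinuousLinearMap.differentiableAt _) h1
  exact (differentiableAt_const (tr n)).clm_comp (h3.clm_comp h2)

theorem fderiv_theta (hα : α ∈ contDiffGroupoid ∞ 𝓘(ℝ, E n)) {y : E n} (hy : y ∈ α.source)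
    (c a : E n) : fderiv ℝ (theta α) y c a =
      tr n (invDeriv α y ∘L fderiv ℝ (fderiv ℝ (fderiv ℝ α)) y c a +
        fderiv ℝ (invDeriv α) y c ∘L fderiv ℝ (fderiv ℝ α) y a) := by
  have hCd := ((contDiffAt_invDeriv hα hy).differentiableAt (by simp)).hasFDerivAt
  have hAd : HasFDerivAt (fderiv ℝ (fderiv ℝ α)) (fderiv ℝ (fderiv ℝ (fderiv ℝ α)) y) y :=
    (((contDiffAt_fderiv hα hy).fderiv_right (m := ∞) (by simp)).differentiableAt
      (by simp)).hasFDerivAt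
  have h1 := (differentiableAt_theta hα hy).hasFDerivAt.clm_apply (hasFDerivAt_const a y)
  have h2 := (tr n).hasFDerivAt.comp y
      (hCd.clm_comp (hAd.clm_apply (hasFDerivAt_const a y)))
  have h3 := congrArg (fun L : E n →L[ℝ] ℝ => L c) (h1.unique h2)
  simpa using h3

theorem theta_closed (hα : α ∈ contDiffGroupoid ∞ 𝓘(ℝ, E n)) {y : E n} (hy : y ∈ α.source)
    (c a : E n) : fderiv ℝ (theta α) y c a = fderiv ℝ (theta α) y a c := by
  have hsym : fderiv ℝ (fderiv ℝ (fderiv ℝ α)) y c a = fderiv ℝ (fderiv ℝ (fderiv ℝ α)) y a c :=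
    ((contDiffAt_fderiv hα hy).isSymmSndFDerivAt
      (by simp only [minSmoothness_of_isRCLikeNormedField]; exact WithTop.coe_le_coe.mpr le_top)).eq c a
  rw [fderiv_theta hα hy, fderiv_theta hα hy, hsym, fderiv_invDeriv hα hy, fderiv_invDeriv hα hy,
    map_add, map_add]
  congr 1
  rw [ContinuousLinearMap.neg_comp, ContinuousLinearMap.neg_comp, map_neg, map_neg]
  have := tr_mul_comm (invDeriv α y ∘L fderiv ℝ (fderiv ℝ α) y c)
    (invDeriv α y ∘L fderiv ℝ (fderiv ℝ α) y a)
  simp only [ContinuousLinearMap.comp_assoc] at this ⊢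
  rw [this]

theorem differentiableAt_lift_snd (hα : α ∈ contDiffGroupoid ∞ 𝓘(ℝ, E n)) {z : BModel n}
    (hz : z.1 ∈ α.source) : DifferentiableAt ℝ (fun z => (lift α z).2) z := by
  have h1 : DifferentiableAt ℝ (fun z : BModel n => theta α z.1) z :=
    DifferentiableAt.comp z (g := theta α) (differentiableAt_theta hα hz) differentiableAt_fst
  have h2 : DifferentiableAt ℝ (fun z : BModel n => invDeriv α z.1) z :=
    DifferentiableAt.comp z (g := invDeriv α)
      ((contDiffAt_invDeriv hα hz).differentiableAt (by simp)) differentiableAt_fst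
  exact (h1.add differentiableAt_snd).clm_comp h2

theorem fderiv_lift (hα : α ∈ contDiffGroupoid ∞ 𝓘(ℝ, E n)) {z : BModel n}
    (hz : z.1 ∈ α.source) (v : BModel n) : fderiv ℝ (lift α) z v =
      (fderiv ℝ α z.1 v.1, fderiv ℝ (fun z => (lift α z).2) z v) := by
  have h1 : HasFDerivAt (fun z : BModel n => α z.1)
      ((fderiv ℝ α z.1) ∘L ContinuousLinearMap.fst ℝ (E n) (E n →L[ℝ] ℝ)) z :=
    HasFDerivAt.comp z (g := α)
      (((contDiffAt_of_mem hα hz).differentiableAt (by simp)).hasFDerivAt) hasFDerivAt_fst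
  have h2 := h1.prodMk (differentiableAt_lift_snd hα hz).hasFDerivAt
  have h3 : fderiv ℝ (lift α) z = _ := h2.fderiv
  rw [h3]
  rfl

theorem lift_snd_comp (hα : α ∈ contDiffGroupoid ∞ 𝓘(ℝ, E n)) {z : BModel n}
    (hz : z.1 ∈ α.source) (a : E n) : (lift α z).2 (fderiv ℝ α z.1 a) = (theta α z.1 + z.2) a :=
  congrArg (fun L : E n →L[ℝ] E n => (theta α z.1 + z.2) (L a)) (invDeriv_comp hα hz)

theorem fderiv_lift_snd (hα : α ∈ contDiffGroupoid ∞ 𝓘(ℝ, E n)) {z : BModel n}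
    (hz : z.1 ∈ α.source) (v : BModel n) (a : E n) :
    (lift α z).2 (fderiv ℝ (fderiv ℝ α) z.1 v.1 a) +
      fderiv ℝ (fun z => (lift α z).2) z v (fderiv ℝ α z.1 a) =
        fderiv ℝ (theta α) z.1 v.1 a + v.2 a := by
  have hAz : HasFDerivAt (fun z : BModel n => fderiv ℝ α z.1)
      ((fderiv ℝ (fderiv ℝ α) z.1) ∘L ContinuousLinearMap.fst ℝ (E n) (E n →L[ℝ] ℝ)) z :=
    HasFDerivAt.comp z (g := fderiv ℝ α)
      (((contDiffAt_fderiv hα hz).differentiableAt (by simp)).hasFDerivAt) hasFDerivAt_fst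
  have hTz : HasFDerivAt (fun z : BModel n => theta α z.1)
      ((fderiv ℝ (theta α) z.1) ∘L ContinuousLinearMap.fst ℝ (E n) (E n →L[ℝ] ℝ)) z :=
    HasFDerivAt.comp z (g := theta α) (differentiableAt_theta hα hz).hasFDerivAt hasFDerivAt_fst
  have h1 := (differentiableAt_lift_snd hα hz).hasFDerivAt.clm_apply
    (hAz.clm_apply (hasFDerivAt_const a z))
  have h2 := (hTz.fun_add hasFDerivAt_snd).clm_apply (hasFDerivAt_const a z)
  have h3 : (fun z : BModel n => (lift α z).2 (fderiv ℝ α z.1 a)) =ᶠ[𝓝 z]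
      (fun z : BModel n => (theta α z.1 + z.2) a) := by
    have : ∀ᶠ z : BModel n in 𝓝 z, z.1 ∈ α.source :=
      (α.open_source.preimage continuous_fst).mem_nhds hz
    filter_upwards [this] with w hw using lift_snd_comp hα hw a
  have h5 := congrArg (fun L : BModel n →L[ℝ] ℝ => L v)
    (h1.unique (h2.congr_of_eventuallyEq h3))
  simpa using h5

theorem symplectic_invariant (hα : α ∈ contDiffGroupoid ∞ 𝓘(ℝ, E n)) (z : BModel n)
    (hz : z.1 ∈ α.source) :
    (symplectic n).compContinuousLinearMap (fderiv ℝ (lift α) z) = symplectic n := by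
  have hsym : ∀ a c, fderiv ℝ (fderiv ℝ α) z.1 a c = fderiv ℝ (fderiv ℝ α) z.1 c a := fun a c =>
    ((contDiffAt_of_mem hα hz).isSymmSndFDerivAt
      (by simp only [minSmoothness_of_isRCLikeNormedField]; exact WithTop.coe_le_coe.mpr le_top)).eq a c
  ext v
  rw [ContinuousAlternatingMap.compContinuousLinearMap_apply, symplectic_apply, symplectic_apply]
  simp only [Function.comp_apply, fderiv_lift hα hz]
  have e1 := fderiv_lift_snd hα hz (v 0) (v 1).1
  have e2 := fderiv_lift_snd hα hz (v 1) (v 0).1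
  rw [hsym (v 1).1 (v 0).1, theta_closed hα hz (v 1).1 (v 0).1] at e2
  linarith

end Invariance

theorem flowPseudogroup_le {n : ℕ} (U : TopologicalSpace.Opens (E n)) (V : E n → E n) :
    flowPseudogroup U V ≤ contDiffGroupoid ∞ 𝓘(ℝ, E n) :=
  sInf_le fun _ hφ _ _ => hφ

/-- The form `dy_i ∧ dy^i`, as a closed form on `B(U/V)`. -/
def chernLosikForm {n : ℕ} (U : TopologicalSpace.Opens (E n)) (V : E n → E n) :
    closedForms (B U) (liftedMaps U (flowPseudogroup U V)) 2 :=
  ⟨fun _ => symplectic n, ⟨contDiffOn_const, by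
      rintro _ ⟨α, hα, -, rfl⟩ z hz
      exact symplectic_invariant (flowPseudogroup_le U V hα) z hz⟩,
    fun z _ => by
      change ContinuousAlternatingMap.alternatizeUncurryFin (fderiv ℝ (fun _ => symplectic n) z) = 0
      rw [fderiv_fun_const]
      exact map_zero (ContinuousAlternatingMap.alternatizeUncurryFinCLM ℝ (BModel n) ℝ)⟩

/-- The first Chern–Losik class of `U/V`: the class of `dy_i ∧ dy^i` in `H²(B(U/V))`. -/
def chernLosikClass {n : ℕ} (U : TopologicalSpace.Opens (E n)) (V : E n → E n) : H2B U V :=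
  (exactForms (B U) (liftedMaps U (flowPseudogroup U V)) 1).mkQ (chernLosikForm U V)

/-- The divergence `∂V^i/∂y^i`. -/
def divergence {n : ℕ} (V : E n → E n) (y : E n) : ℝ := tr n (fderiv ℝ V y)

/-- The extension of `V` to a vector field on `B`, with components `V^i` and
`∂²V^j/∂y^j∂y^i - (∂V^j/∂y^i) y_j`. -/
def extendedField {n : ℕ} (V : E n → E n) (z : BModel n) : BModel n :=
  (V z.1, fderiv ℝ (divergence V) z.1 - z.2 ∘L fderiv ℝ V z.1)

/-- `G` is a smooth solution on `B(U)` of the equation `Ṽ G = -∂V^i/∂y^i + R`. -/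
def IsSolution {n : ℕ} (U : TopologicalSpace.Opens (E n)) (V : E n → E n) (R : ℝ)
    (G : BModel n → ℝ) : Prop :=
  ContDiffOn ℝ ∞ G (B U) ∧
    ∀ z ∈ B U, fderiv ℝ G z (extendedField V z) = -divergence V z.1 + R

/-- The open unit disc in `ℝ²`. -/
def disc : TopologicalSpace.Opens (E 2) := ⟨Metric.ball 0 1, Metric.isOpen_ball⟩

/-- The radial vector field with components `f(r) y¹`, `f(r) y²`. -/
def radialField (f : ℝ → ℝ) (y : E 2) : E 2 := f ‖y‖ • y

end CL

end

/-! The covector `theta α` is the differential of `log |det Dα|`. It therefore obeys the cocycle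
rule `theta_trans` and vanishes on linear maps. An invariant primitive of `dy_i ∧ dy^i` is the
tautological form plus a correction that absorbs this cocycle, and the class measures whether a
correction exists that is smooth across the origin.

If `f 0 ≠ 0`, a radial diffeomorphism `ψ` conjugates the field to its linear part `f 0 • y`
(`exists_linearization_radialField`). Flow maps become homotheties, so `theta ψ` is the required
correction (`chernLosikClass_eq_zero_of_section`).

If `f 0 = 0`, it suffices to look at the points `(x, p)` over the positive half of an axis. Let `D =
2 f + x f'` be the divergence and `w = log |x² f|`, so that `w' = D / (x f)`. The lifted flow
preserves `x f p - D`. An invariant primitive differs from the tautological form by some `dG`, and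
`G + w` changes by a constant `c` under the lift of a contracting flow map `h`
(`exists_primitive_of_chernLosikClass_eq_zero`, `exists_contraction`). Follow `N` steps of an orbit
`x_n → 0`, with the initial covector chosen so that the final one is `0`: both end values of `G`
converge as `N → ∞`, hence so does `w(x_N) - N c`. The increments of `w` tend to `D(0) = 0`, which
forces `c = 0`; but `w → -∞` at the origin, a contradiction. The infinitesimal version of this
argument, along orbits of the lifted field, excludes solutions of `(∗)`. -/

noncomputable section

namespace CL

/-! ### Hadamard's lemma and parity of derivatives in one variable. -/

section SmoothOneVariable

open MeasureTheory

/-- Differentiation under the integral sign. The weight `t ^ k` makes the family of such integrals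
stable under differentiation, since each derivative produces one more factor `t`. -/
theorem hasDerivAt_integral_pow_mul_comp_mul {h : ℝ → ℝ} (hh : ContDiffOn ℝ ∞ h (Ioo (-1) 1))
    (k : ℕ) {x : ℝ} (hx : x ∈ Ioo (-1 : ℝ) 1) :
    HasDerivAt (fun x => ∫ t in (0 : ℝ)..1, t ^ k * h (t * x))
      (∫ t in (0 : ℝ)..1, t ^ (k + 1) * deriv h (t * x)) x := by
  have hd := (contDiffOn_infty_iff_deriv_of_isOpen isOpen_Ioo).1 hh
  have hab : |x| < 1 := abs_lt.2 hx
  -- The interval `[-a, a]` is a compact neighbourhood of `x` inside `(-1, 1)`, stable under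
  -- multiplication by `t ∈ [0, 1]`; the bound on `deriv h` there dominates the integrand.
  set a := (1 + |x|) / 2 with ha
  have ha0 : 0 ≤ a := by positivity
  have hxa : |x| < a := by rw [ha]; linarith
  have ha1 : a < 1 := by rw [ha]; linarith
  have hsub : Icc (-a) a ⊆ Ioo (-1 : ℝ) 1 := fun y hy => ⟨by linarith [hy.1], by linarith [hy.2]⟩
  have hmul : ∀ t ∈ Icc (0 : ℝ) 1, ∀ y ∈ Icc (-a) a, t * y ∈ Icc (-a) a := by
    intro t ht y hy
    rw [mem_Icc, ← abs_le] at hy ⊢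
    rw [abs_mul, abs_of_nonneg ht.1]
    nlinarith [abs_nonneg y, ht.2, ht.1]
  obtain ⟨C, hC⟩ := (isCompact_Icc (a := -a) (b := a)).exists_bound_of_continuousOn
    (hd.2.continuousOn.mono hsub)
  have hcont : ∀ y ∈ Icc (-a) a, ∀ g : ℝ → ℝ, ContinuousOn g (Ioo (-1) 1) → ∀ m : ℕ,
      ContinuousOn (fun t : ℝ => t ^ m * g (t * y)) (uIcc 0 1) := by
    intro y hy g hg m
    rw [uIcc_of_le zero_le_one]
    exact (continuousOn_id.pow m).mul (hg.comp (by fun_prop) fun t ht => hsub (hmul t ht y hy))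
  have hnhds : Icc (-a) a ∈ 𝓝 x := Icc_mem_nhds (abs_lt.1 hxa).1 (abs_lt.1 hxa).2
  have hmeas : ∀ y ∈ Icc (-a) a, ∀ g : ℝ → ℝ, ContinuousOn g (Ioo (-1) 1) → ∀ m : ℕ,
      AEStronglyMeasurable (fun t : ℝ => t ^ m * g (t * y)) (volume.restrict (uIoc 0 1)) :=
    fun y hy g hg m =>
      ((hcont y hy g hg m).mono uIoc_subset_uIcc).aestronglyMeasurable measurableSet_uIoc
  refine (intervalIntegral.hasDerivAt_integral_of_dominated_loc_of_deriv_le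
    (F := fun x t => t ^ k * h (t * x)) (F' := fun x t => t ^ (k + 1) * deriv h (t * x))
    (bound := fun _ => C) hnhds ?_ ?_ ?_ ?_ ?_ ?_).2
  · filter_upwards [hnhds] with y hy using hmeas y hy h hh.continuousOn k
  · exact (hcont x (mem_of_mem_nhds hnhds) h hh.continuousOn k).intervalIntegrable
  · exact hmeas x (mem_of_mem_nhds hnhds) _ hd.2.continuousOn (k + 1)
  · refine Filter.Eventually.of_forall fun t ht y hy => ?_
    rw [uIoc_of_le zero_le_one] at ht
    have h1 := hC (t * y) (hmul t ⟨ht.1.le, ht.2⟩ y hy)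
    rw [norm_mul, norm_pow, Real.norm_of_nonneg ht.1.le]
    exact (mul_le_of_le_one_left (norm_nonneg _) (pow_le_one₀ ht.1.le ht.2)).trans h1
  · exact intervalIntegrable_const
  · refine Filter.Eventually.of_forall fun t ht y hy => ?_
    rw [uIoc_of_le zero_le_one] at ht
    have hty := hsub (hmul t ⟨ht.1.le, ht.2⟩ y hy)
    have h1 : HasDerivAt h (deriv h (t * y)) (t * y) :=
      ((hd.1 _ hty).differentiableAt (isOpen_Ioo.mem_nhds hty)).hasDerivAt
    have h2 := (h1.comp y ((hasDerivAt_id y).const_mul t)).const_mul (t ^ k)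
    refine h2.congr_deriv ?_
    ring

theorem contDiffOn_integral_pow_mul_comp_mul (n : ℕ) : ∀ {h : ℝ → ℝ},
    ContDiffOn ℝ ∞ h (Ioo (-1) 1) → ∀ k : ℕ,
    ContDiffOn ℝ n (fun x => ∫ t in (0 : ℝ)..1, t ^ k * h (t * x)) (Ioo (-1) 1) := by
  induction n with
  | zero =>
    intro h hh k
    exact contDiffOn_zero.2 fun x hx =>
      (hasDerivAt_integral_pow_mul_comp_mul hh k hx).continuousAt.continuousWithinAt
  | succ n ih =>
    intro h hh k
    push_cast
    refine (contDiffOn_succ_iff_deriv_of_isOpen isOpen_Ioo).2 ⟨fun x hx =>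
      (hasDerivAt_integral_pow_mul_comp_mul hh k hx).differentiableAt.differentiableWithinAt,
      by simp, ?_⟩
    exact (ih ((contDiffOn_infty_iff_deriv_of_isOpen isOpen_Ioo).1 hh).2 (k + 1)).congr
      fun x hx => (hasDerivAt_integral_pow_mul_comp_mul hh k hx).deriv

/-- Hadamard's lemma in one variable. -/
theorem contDiffOn_dslope_zero {h : ℝ → ℝ} (hh : ContDiffOn ℝ ∞ h (Ioo (-1) 1)) :
    ContDiffOn ℝ ∞ (dslope h 0) (Ioo (-1) 1) := by
  have hd := (contDiffOn_infty_iff_deriv_of_isOpen isOpen_Ioo).1 hh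
  refine contDiffOn_infty.2 fun n =>
    -- The difference quotient `(h x - h 0) / x` is the average of `h' (t x)` over `t ∈ [0, 1]`.
    (contDiffOn_integral_pow_mul_comp_mul n hd.2 0).congr fun x hx => ?_
  rcases eq_or_ne x 0 with rfl | hx0
  · simp
  · have hsub : uIcc 0 x ⊆ Ioo (-1 : ℝ) 1 := (ordConnected_Ioo).uIcc_subset (by simp) hx
    have h1 : ∫ y in (0 : ℝ)..x, deriv h y = h x - h 0 :=
      intervalIntegral.integral_deriv_eq_sub
        (fun y hy => (hd.1 y (hsub hy)).differentiableAt (isOpen_Ioo.mem_nhds (hsub hy)))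
        (hd.2.continuousOn.mono hsub).intervalIntegrable
    have h2 := intervalIntegral.integral_comp_mul_left (a := 0) (b := 1) (deriv h) hx0
    rw [mul_zero, mul_one, h1] at h2
    rw [dslope_of_ne _ hx0, slope_def_field, sub_zero]
    simp only [pow_zero, one_mul, mul_comm _ x, h2, smul_eq_mul]
    field_simp

theorem deriv_neg_of_even {g : ℝ → ℝ} (hg : ∀ x ∈ Ioo (-1 : ℝ) 1, g (-x) = g x) {x : ℝ}
    (hx : x ∈ Ioo (-1 : ℝ) 1) : deriv g (-x) = -deriv g x := by
  have h1 : (fun y => g (-y)) =ᶠ[𝓝 x] g := by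
    filter_upwards [isOpen_Ioo.mem_nhds hx] with y hy using hg y hy
  rw [← h1.deriv_eq, deriv_comp_neg, neg_neg]

theorem deriv_zero_of_even {g : ℝ → ℝ} (hg : ∀ x ∈ Ioo (-1 : ℝ) 1, g (-x) = g x) :
    deriv g 0 = 0 := by
  have := deriv_neg_of_even hg (x := 0) (by simp)
  rw [neg_zero] at this
  linarith

theorem even_dslope_deriv {g : ℝ → ℝ} (hg : ∀ x ∈ Ioo (-1 : ℝ) 1, g (-x) = g x) :
    ∀ x ∈ Ioo (-1 : ℝ) 1, dslope (deriv g) 0 (-x) = dslope (deriv g) 0 x := by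
  intro x hx
  rcases eq_or_ne x 0 with rfl | hx0
  · simp
  · rw [dslope_of_ne _ hx0, dslope_of_ne _ (neg_ne_zero.2 hx0), slope_def_field, slope_def_field,
      deriv_neg_of_even hg hx, deriv_zero_of_even hg]
    simp [neg_div_neg_eq]

theorem mul_dslope_deriv_of_even {g : ℝ → ℝ} (hg : ∀ x ∈ Ioo (-1 : ℝ) 1, g (-x) = g x) (x : ℝ) :
    x * dslope (deriv g) 0 x = deriv g x := by
  have := sub_smul_dslope (deriv g) 0 x
  rwa [sub_zero, deriv_zero_of_even hg, sub_zero, smul_eq_mul] at this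

end SmoothOneVariable

/-! ### Smoothness of even functions of the norm. -/

section RadialFunctions

variable {n : ℕ}

theorem norm_mem_Ioo {y : E n} (hy : y ∈ Metric.ball (0 : E n) 1) : ‖y‖ ∈ Ioo (-1 : ℝ) 1 :=
  ⟨by linarith [norm_nonneg y], by simpa using hy⟩

/-- The factor is `g'(r) / r`, written as a `dslope` so that it also makes sense at `r = 0`, where
`g'` vanishes by parity. -/
theorem hasFDerivAt_comp_norm_of_even {g : ℝ → ℝ} (hd : DifferentiableOn ℝ g (Ioo (-1) 1))
    (hg : ∀ x ∈ Ioo (-1 : ℝ) 1, g (-x) = g x) {y : E n} (hy : y ∈ Metric.ball (0 : E n) 1) :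
    HasFDerivAt (fun y : E n => g ‖y‖) (dslope (deriv g) 0 ‖y‖ • innerSL ℝ y) y := by
  have h1 : HasDerivAt g (deriv g ‖y‖) ‖y‖ :=
    ((hd _ (norm_mem_Ioo hy)).differentiableAt (isOpen_Ioo.mem_nhds (norm_mem_Ioo hy))).hasDerivAt
  rcases eq_or_ne y 0 with rfl | hy0
  · rw [norm_zero, deriv_zero_of_even hg] at h1
    have h2 := h1.hasFDerivAt
    simp only [map_zero, smul_zero]
    rw [hasFDerivAt_iff_isLittleO_nhds_zero] at h2 ⊢
    -- At the origin `g'(0) = 0` gives `g(s) - g(0) = o(s)`, and `s = ‖v‖` is substituted.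
    have h3 := h2.comp_tendsto (continuous_norm.tendsto' (0 : E n) 0 norm_zero)
    refine (h3.congr_left fun v => ?_).trans_isBigO ?_
    · simp
    · exact (Asymptotics.isBigO_refl _ _).norm_left
  · have h2 : HasFDerivAt (fun y : E n => ‖y‖) (‖y‖⁻¹ • innerSL ℝ y) y := by
      have h3 := ((hasStrictFDerivAt_norm_sq y).hasFDerivAt).sqrt (by simpa using hy0)
      simp only [Real.sqrt_sq (norm_nonneg _)] at h3
      refine h3.congr_fderiv ?_
      ext v
      simp
      ring
    refine (h1.comp_hasFDerivAt y h2).congr_fderiv ?_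
    rw [smul_smul, ← mul_dslope_deriv_of_even hg ‖y‖]
    congr 1
    have := norm_ne_zero_iff.2 hy0
    field_simp

/-- Induction on the order: the derivative is a linear function of `y` times a radial function whose
profile `g'(r) / r` is again smooth and even. -/
theorem contDiffOn_comp_norm_of_even {g : ℝ → ℝ} (hs : ContDiffOn ℝ ∞ g (Ioo (-1) 1))
    (hg : ∀ x ∈ Ioo (-1 : ℝ) 1, g (-x) = g x) :
    ContDiffOn ℝ ∞ (fun y : E n => g ‖y‖) (Metric.ball 0 1) := by
  refine contDiffOn_infty.2 fun m => ?_
  induction m generalizing g with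
  | zero =>
    exact contDiffOn_zero.2 (hs.continuousOn.comp continuous_norm.continuousOn
      fun y hy => norm_mem_Ioo hy)
  | succ m ih =>
    have hd := (contDiffOn_infty_iff_deriv_of_isOpen isOpen_Ioo).1 hs
    push_cast
    refine (contDiffOn_succ_iff_fderiv_of_isOpen Metric.isOpen_ball).2 ⟨fun y hy =>
      (hasFDerivAt_comp_norm_of_even hd.1 hg hy).differentiableAt.differentiableWithinAt,
      by simp, ?_⟩
    refine ContDiffOn.congr ?_ fun y hy => (hasFDerivAt_comp_norm_of_even hd.1 hg hy).fderiv
    exact (ih (contDiffOn_dslope_zero hd.2) (even_dslope_deriv hg)).smul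
      (innerSL ℝ).contDiff.contDiffOn

end RadialFunctions

/-! ### The cocycle `theta`. -/

section Theta

variable {n : ℕ} {α β : OpenPartialHomeomorph (E n) (E n)}

theorem mem_contDiffGroupoid_of_contDiffOn (h1 : ContDiffOn ℝ ∞ α α.source)
    (h2 : ContDiffOn ℝ ∞ α.symm α.target) : α ∈ contDiffGroupoid ∞ 𝓘(ℝ, E n) := by
  rw [contDiffGroupoid, mem_groupoid_of_pregroupoid]
  simpa [contDiffPregroupoid] using ⟨h1, h2⟩

theorem eq_invDeriv_of_comp_eq_id (hα : α ∈ contDiffGroupoid ∞ 𝓘(ℝ, E n)) {y : E n}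
    (hy : y ∈ α.source) {T : E n →L[ℝ] E n}
    (hT : T ∘L fderiv ℝ α y = ContinuousLinearMap.id ℝ (E n)) : T = invDeriv α y := by
  have := congrArg (fun L : E n →L[ℝ] E n => L ∘L invDeriv α y) hT
  simpa only [ContinuousLinearMap.comp_assoc, comp_invDeriv hα hy, ContinuousLinearMap.comp_id,
    ContinuousLinearMap.id_comp] using this

theorem theta_congr (hα : α ∈ contDiffGroupoid ∞ 𝓘(ℝ, E n))
    (hβ : β ∈ contDiffGroupoid ∞ 𝓘(ℝ, E n)) {y : E n} (hyα : y ∈ α.source) (hyβ : y ∈ β.source)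
    (h : α =ᶠ[𝓝 y] β) : theta α y = theta β y := by
  have h1 : invDeriv α y = invDeriv β y :=
    eq_invDeriv_of_comp_eq_id hβ hyβ (by rw [← h.fderiv_eq, invDeriv_comp hα hyα])
  ext a
  rw [theta_apply, theta_apply, h1, h.fderiv.fderiv_eq]

theorem fderiv_trans (hα : α ∈ contDiffGroupoid ∞ 𝓘(ℝ, E n))
    (hβ : β ∈ contDiffGroupoid ∞ 𝓘(ℝ, E n)) {y : E n} (hy : y ∈ α.source)
    (hy' : α y ∈ β.source) :
    fderiv ℝ (α.trans β) y = fderiv ℝ β (α y) ∘L fderiv ℝ α y :=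
  fderiv_comp y ((contDiffAt_of_mem hβ hy').differentiableAt (by simp))
    ((contDiffAt_of_mem hα hy).differentiableAt (by simp))

theorem invDeriv_trans (hα : α ∈ contDiffGroupoid ∞ 𝓘(ℝ, E n))
    (hβ : β ∈ contDiffGroupoid ∞ 𝓘(ℝ, E n)) {y : E n} (hy : y ∈ α.source)
    (hy' : α y ∈ β.source) :
    invDeriv (α.trans β) y = invDeriv α y ∘L invDeriv β (α y) := by
  refine (eq_invDeriv_of_comp_eq_id (StructureGroupoid.trans _ hα hβ)
    (by rw [OpenPartialHomeomorph.trans_source]; exact ⟨hy, hy'⟩) ?_).symm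
  rw [fderiv_trans hα hβ hy hy', ContinuousLinearMap.comp_assoc,
    ← ContinuousLinearMap.comp_assoc (invDeriv β (α y)), invDeriv_comp hβ hy',
    ContinuousLinearMap.id_comp, invDeriv_comp hα hy]

/-- The chain rule for `d log |det Dα|`. Differentiating `Dβ(α) ∘ Dα` gives two terms, and cyclicity
of the trace removes the conjugation by `Dα` from one of them. -/
theorem theta_trans (hα : α ∈ contDiffGroupoid ∞ 𝓘(ℝ, E n))
    (hβ : β ∈ contDiffGroupoid ∞ 𝓘(ℝ, E n)) {y : E n} (hy : y ∈ α.source)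
    (hy' : α y ∈ β.source) :
    theta (α.trans β) y = theta β (α y) ∘L fderiv ℝ α y + theta α y := by
  have h1 : fderiv ℝ (α.trans β) =ᶠ[𝓝 y] fun w => fderiv ℝ β (α w) ∘L fderiv ℝ α w := by
    have hs : y ∈ (α.trans β).source := by
      rw [OpenPartialHomeomorph.trans_source]; exact ⟨hy, hy'⟩
    filter_upwards [(α.trans β).open_source.mem_nhds hs] with w hw
    rw [OpenPartialHomeomorph.trans_source] at hw
    exact fderiv_trans hα hβ hw.1 hw.2
  have hA := ((contDiffAt_of_mem hα hy).differentiableAt (by simp)).hasFDerivAt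
  have hA' := ((contDiffAt_fderiv hα hy).differentiableAt (by simp)).hasFDerivAt
  have hB' := ((contDiffAt_fderiv hβ hy').differentiableAt (by simp)).hasFDerivAt
  have h2 := ((hB'.comp y hA).clm_comp hA').congr_of_eventuallyEq h1
  ext a
  have h3 : fderiv ℝ (fderiv ℝ (α.trans β)) y a =
      fderiv ℝ β (α y) ∘L fderiv ℝ (fderiv ℝ α) y a +
        fderiv ℝ (fderiv ℝ β) (α y) (fderiv ℝ α y a) ∘L fderiv ℝ α y := by
    rw [h2.fderiv]; rfl
  rw [theta_apply, h3, invDeriv_trans hα hβ hy hy', _root_.add_apply,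
    ContinuousLinearMap.comp_apply, theta_apply, theta_apply, ContinuousLinearMap.comp_add, map_add,
    add_comm]
  congr 1
  · rw [ContinuousLinearMap.comp_assoc, tr_mul_comm]
    simp only [ContinuousLinearMap.comp_assoc, comp_invDeriv hα hy, ContinuousLinearMap.comp_id]
  · rw [ContinuousLinearMap.comp_assoc, ← ContinuousLinearMap.comp_assoc (invDeriv β (α y)),
      invDeriv_comp hβ hy', ContinuousLinearMap.id_comp]

theorem contDiffOn_theta (hα : α ∈ contDiffGroupoid ∞ 𝓘(ℝ, E n)) :
    ContDiffOn ℝ ∞ (theta α) α.source := fun y hy => by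
  have h1 : ContDiffAt ℝ ∞ (fderiv ℝ (fderiv ℝ α)) y :=
    (contDiffAt_fderiv hα hy).fderiv_right (by simp)
  have h2 : ContDiffAt ℝ ∞
      (fun w => ContinuousLinearMap.compL ℝ (E n) (E n) (E n) (invDeriv α w)) y :=
    ContDiffAt.comp y (g := ContinuousLinearMap.compL ℝ (E n) (E n) (E n))
      (ContinuousLinearMap.contDiff _).contDiffAt (contDiffAt_invDeriv hα hy)
  have h3 : ContDiffAt ℝ ∞ (fun w => (ContinuousLinearMap.compL ℝ (E n) (E n) (E n)
      (invDeriv α w)) ∘L fderiv ℝ (fderiv ℝ α) w) y := h2.clm_comp h1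
  have h4 : ContDiffAt ℝ ∞ (fun _ : E n => tr n) y := contDiffAt_const
  exact (h4.clm_comp h3).contDiffWithinAt

/-- An invertible linear map as a local diffeomorphism. -/
def linearHomeomorph (A : E n ≃L[ℝ] E n) : OpenPartialHomeomorph (E n) (E n) :=
  A.toHomeomorph.toOpenPartialHomeomorph

theorem linearHomeomorph_mem (A : E n ≃L[ℝ] E n) :
    linearHomeomorph A ∈ contDiffGroupoid ∞ 𝓘(ℝ, E n) :=
  mem_contDiffGroupoid_of_contDiffOn A.contDiff.contDiffOn A.symm.contDiff.contDiffOn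

theorem theta_linearHomeomorph (A : E n ≃L[ℝ] E n) (y : E n) :
    theta (linearHomeomorph A) y = 0 := by
  ext a
  have h1 : fderiv ℝ (linearHomeomorph A) = fun _ => (A : E n →L[ℝ] E n) :=
    funext fun x => A.hasFDerivAt.fderiv
  rw [theta_apply, h1, fderiv_fun_const]
  simp

/-- If `α` intertwines linear maps near `y` with a local diffeomorphism `ψ`, in the sense that
`ψ ∘ α = A ∘ ψ`, then the covector field `theta ψ` transforms under `α` by `theta α`. -/
theorem theta_comp_add_theta_of_eventuallyEq {ψ : OpenPartialHomeomorph (E n) (E n)}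
    (hψ : ψ ∈ contDiffGroupoid ∞ 𝓘(ℝ, E n)) (hα : α ∈ contDiffGroupoid ∞ 𝓘(ℝ, E n))
    {A : E n ≃L[ℝ] E n} {y : E n} (hy : y ∈ α.source) (hyψ : y ∈ ψ.source)
    (hy' : α y ∈ ψ.source) (h : ∀ᶠ w in 𝓝 y, ψ (α w) = A (ψ w)) :
    theta ψ (α y) ∘L fderiv ℝ α y + theta α y = theta ψ y := by
  have hA := linearHomeomorph_mem A
  rw [← theta_trans hα hψ hy hy', theta_congr (β := ψ.trans (linearHomeomorph A))
    (StructureGroupoid.trans _ hα hψ) (StructureGroupoid.trans _ hψ hA) (by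
      rw [OpenPartialHomeomorph.trans_source]; exact ⟨hy, hy'⟩) (by
      rw [OpenPartialHomeomorph.trans_source]; exact ⟨hyψ, mem_univ _⟩) h,
    theta_trans hψ hA hyψ (mem_univ _), theta_linearHomeomorph]
  simp

/-- The linear symmetries of `α` that fix `y` preserve the covector `theta α y`. -/
theorem theta_apply_of_commute (hα : α ∈ contDiffGroupoid ∞ 𝓘(ℝ, E n)) {A : E n ≃L[ℝ] E n}
    {y : E n} (hy : y ∈ α.source) (hAy : A y = y) (h : ∀ᶠ w in 𝓝 y, α (A w) = A (α w)) (a : E n) :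
    theta α y (A a) = theta α y a := by
  have h1 := theta_comp_add_theta_of_eventuallyEq (ψ := α) (α := linearHomeomorph A) hα
    (linearHomeomorph_mem A) (A := A) (y := y) (mem_univ _) hy
    (show A y ∈ α.source by rwa [hAy]) h
  rw [theta_linearHomeomorph, add_zero] at h1
  have h2 : fderiv ℝ (linearHomeomorph A) y = (A : E n →L[ℝ] E n) := A.hasFDerivAt.fderiv
  have h3 : linearHomeomorph A y = y := hAy
  rw [h2, h3] at h1
  exact congrArg (fun L : E n →L[ℝ] ℝ => L a) h1

end Theta

/-! ### Invariant sections of `B` and vanishing of the class. -/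

section Vanishing

variable {n : ℕ} {U : TopologicalSpace.Opens (E n)} {V : E n → E n}

/-- The local diffeomorphisms that preserve `U` and whose lifts preserve the section `y ↦ -g y`
of `B` over `U`. -/
def sectionGroupoid (U : TopologicalSpace.Opens (E n)) (g : E n → E n →L[ℝ] ℝ) :
    StructureGroupoid (E n) where
  -- A groupoid on the whole space also has members whose source leaves `U`. The condition on `U` is
  -- an equivalence so that it passes to compositions and inverses.
  members := {α | α ∈ contDiffGroupoid ∞ 𝓘(ℝ, E n) ∧ ∀ y ∈ α.source, (y ∈ U ↔ α y ∈ U) ∧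
    (y ∈ U → g (α y) ∘L fderiv ℝ α y + theta α y = g y)}
  trans' := by
    rintro α β ⟨hα, hα'⟩ ⟨hβ, hβ'⟩
    refine ⟨StructureGroupoid.trans _ hα hβ, fun y hy => ?_⟩
    rw [OpenPartialHomeomorph.trans_source] at hy
    obtain ⟨h1, h2⟩ := hα' y hy.1
    obtain ⟨h3, h4⟩ := hβ' (α y) hy.2
    refine ⟨h1.trans h3, fun hyU => ?_⟩
    rw [fderiv_trans hα hβ hy.1 hy.2, theta_trans hα hβ hy.1 hy.2, ← h2 hyU, ← h4 (h1.1 hyU),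
      ContinuousLinearMap.add_comp, ContinuousLinearMap.comp_assoc, add_assoc]
    rfl
  symm' := by
    rintro α ⟨hα, hα'⟩
    have hs := StructureGroupoid.symm _ hα
    refine ⟨hs, fun x hx => ?_⟩
    obtain ⟨y, hy, rfl⟩ : ∃ y ∈ α.source, α y = x :=
      ⟨α.symm x, α.map_target hx, α.right_inv hx⟩
    obtain ⟨h1, h2⟩ := hα' y hy
    have h0 : α.symm (α y) = y := α.left_inv hy
    rw [h0]
    refine ⟨h1.symm, fun hyU => ?_⟩
    -- The composite has the germ of the identity, so the cocycle rule expresses `theta α.symm`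
    -- through `theta α`.
    have h3 : theta (α.trans α.symm) y = 0 := by
      rw [← theta_linearHomeomorph (ContinuousLinearEquiv.refl ℝ (E n)) y]
      refine theta_congr (StructureGroupoid.trans _ hα hs) (linearHomeomorph_mem _) (by
        rw [OpenPartialHomeomorph.trans_source]; exact ⟨hy, hx⟩) (mem_univ _) ?_
      filter_upwards [α.open_source.mem_nhds hy] with w hw using α.left_inv hw
    rw [theta_trans hα hs hy hx] at h3
    have h4 := congrArg (fun L : E n →L[ℝ] ℝ => L ∘L invDeriv α y) h3
    simp only [ContinuousLinearMap.add_comp, ContinuousLinearMap.comp_assoc, comp_invDeriv hα hy,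
      ContinuousLinearMap.comp_id, ContinuousLinearMap.zero_comp] at h4
    rw [← h2 (h1.2 hyU), ContinuousLinearMap.add_comp, ContinuousLinearMap.comp_assoc]
    have h5 : fderiv ℝ α y ∘L fderiv ℝ α.symm (α y) = _ := comp_invDeriv hα hy
    rw [h5, ContinuousLinearMap.comp_id, add_assoc, add_comm (theta α y ∘L _)]
    exact add_eq_left.2 h4
  id_mem' := by
    refine ⟨StructureGroupoid.id_mem _, fun y _ => ⟨Iff.rfl, fun _ => ?_⟩⟩
    have h1 : theta (OpenPartialHomeomorph.refl (E n)) y = 0 :=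
      theta_linearHomeomorph (ContinuousLinearEquiv.refl ℝ (E n)) y
    have h2 : fderiv ℝ (OpenPartialHomeomorph.refl (E n)) y = ContinuousLinearMap.id ℝ (E n) :=
      fderiv_id
    rw [h1, h2, ContinuousLinearMap.comp_id, add_zero]
    rfl
  locality' := by
    intro α h
    refine ⟨StructureGroupoid.locality _ fun y hy => ?_, fun y hy => ?_⟩
    · obtain ⟨s, hs, hys, h'⟩ := h y hy
      exact ⟨s, hs, hys, h'.1⟩
    · obtain ⟨s, hs, hys, h'⟩ := h y hy
      exact h'.2 y ⟨hy, by rwa [hs.interior_eq]⟩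
  mem_of_eqOnSource' := by
    rintro α β ⟨hα, hα'⟩ h
    have hβ := StructureGroupoid.mem_of_eqOnSource _ hα h
    refine ⟨hβ, fun y hy => ?_⟩
    have hyα : y ∈ α.source := by rw [← h.1]; exact hy
    have h1 : β =ᶠ[𝓝 y] α := by
      filter_upwards [β.open_source.mem_nhds hy] with w hw using h.2 hw
    rw [theta_congr hβ hα hy hyα h1, h1.fderiv_eq, h1.eq_of_nhds]
    exact hα' y hyα

theorem chernLosikClass_eq_zero_iff :
    chernLosikClass U V = 0 ↔ ∃ η ∈ invForms (B U) (liftedMaps U (flowPseudogroup U V)) 1,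
      ∀ z ∈ B U, extDeriv η z = symplectic n := by
  rw [chernLosikClass, Submodule.mkQ_apply, Submodule.Quotient.mk_eq_zero]
  rfl

/-- The one-form on `B` that is the sum of the tautological form and the pullback of `g`. -/
def tautologicalAdd (g : E n → E n →L[ℝ] ℝ) (z : BModel n) : BModel n →L[ℝ] ℝ :=
  (z.2 + g z.1) ∘L ContinuousLinearMap.fst ℝ (E n) (E n →L[ℝ] ℝ)

theorem extDeriv_ofSubsingleton_apply {W : Type} [NormedAddCommGroup W] [NormedSpace ℝ W]
    {L : W → W →L[ℝ] ℝ} {z : W} (hL : DifferentiableAt ℝ L z) (v : Fin 2 → W) :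
    extDeriv (fun z => ContinuousAlternatingMap.ofSubsingletonLIE (0 : Fin 1) (L z)) z v =
      fderiv ℝ L z (v 0) (v 1) - fderiv ℝ L z (v 1) (v 0) := by
  have h : DifferentiableAt ℝ
      (fun z => ContinuousAlternatingMap.ofSubsingletonLIE (𝕜 := ℝ) (0 : Fin 1) (L z)) z :=
    (LinearIsometryEquiv.differentiableAt _).comp z hL
  have h1 : ∀ a b : W, fderiv ℝ (fun z => L z a) z b = fderiv ℝ L z b a := fun a b => by
    rw [(hL.hasFDerivAt.clm_apply (hasFDerivAt_const a z)).fderiv]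
    simp
  rw [extDeriv_apply h, Fin.sum_univ_two]
  simp [Fin.removeNth, Fin.tail, h1, ← sub_eq_add_neg]

/-- The lifts act on the fibres by affine maps with inhomogeneous part `theta`. Adding `g` to the
tautological form cancels that part, and since `g` is closed the differential remains the symplectic
form. It is enough to test flow maps, because `sectionGroupoid` is a pseudogroup and the flow
pseudogroup is the smallest one containing them. -/
theorem chernLosikClass_eq_zero_of_section {g : E n → E n →L[ℝ] ℝ} (hg : ContDiffOn ℝ ∞ g U)
    (hclosed : ∀ y ∈ U, ∀ a c, fderiv ℝ g y a c = fderiv ℝ g y c a)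
    (hflow : ∀ φ ∈ contDiffGroupoid ∞ 𝓘(ℝ, E n), ∀ t : ℝ, IsFlowMap U V t φ → ∀ y ∈ φ.source,
      g (φ y) ∘L fderiv ℝ φ y + theta φ y = g y) :
    chernLosikClass U V = 0 := by
  have hle : flowPseudogroup U V ≤ sectionGroupoid U g := by
    refine sInf_le fun φ hφ t ht => ⟨hφ, fun y hy => ⟨?_, fun _ => hflow φ hφ t ht y hy⟩⟩
    obtain ⟨γ, h0, h1, h2, -⟩ := ht y hy
    exact ⟨fun _ => h1 ▸ h2 t right_mem_uIcc, fun _ => h0 ▸ h2 0 left_mem_uIcc⟩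
  have hsmooth : ContDiffOn ℝ ∞ (tautologicalAdd g) (B U) :=
    (contDiff_snd.contDiffOn.add (hg.comp contDiff_fst.contDiffOn fun z hz => hz)).clm_comp
      contDiffOn_const
  rw [chernLosikClass_eq_zero_iff]
  refine ⟨fun z => ContinuousAlternatingMap.ofSubsingletonLIE (0 : Fin 1) (tautologicalAdd g z),
    ⟨(LinearIsometryEquiv.contDiff _).comp_contDiffOn hsmooth, ?_⟩, fun z hz => ?_⟩
  · rintro _ ⟨α, hα, hαU, rfl⟩ z hz
    have hα' := flowPseudogroup_le U V hα
    ext v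
    have h1 := lift_snd_comp hα' hz (v 0).1
    have h2 := congrArg (fun L : E n →L[ℝ] ℝ => L (v 0).1) (((hle hα).2 z.1 hz).2 (hαU hz))
    simp only [_root_.add_apply, ContinuousLinearMap.comp_apply] at h1 h2
    simp [tautologicalAdd, fderiv_lift hα' hz, h1]
    rw [← h2]
    simp only [lift]
    ring
  · have hd := (hsmooth.contDiffAt ((B U).isOpen.mem_nhds hz)).differentiableAt (by simp)
    have hgz : HasFDerivAt g (fderiv ℝ g z.1) z.1 :=
      ((hg.contDiffAt (U.isOpen.mem_nhds hz)).differentiableAt (by simp)).hasFDerivAt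
    have h1 := ((hasFDerivAt_snd (𝕜 := ℝ) (p := z)).add (hgz.comp z hasFDerivAt_fst)).clm_comp
      (hasFDerivAt_const (ContinuousLinearMap.fst ℝ (E n) (E n →L[ℝ] ℝ)) z)
    have h2 : ∀ v w : BModel n, fderiv ℝ (tautologicalAdd g) z v w =
        v.2 w.1 + fderiv ℝ g z.1 v.1 w.1 := fun v w => by
      have h3 : fderiv ℝ (tautologicalAdd g) z = _ := h1.fderiv
      rw [h3]
      simp
    ext v
    rw [extDeriv_ofSubsingleton_apply hd, h2, h2, symplectic_apply, hclosed z.1 hz]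
    ring

end Vanishing

/-! ### Injective local diffeomorphisms. -/

section InverseFunction

variable {X Y : Type*} [NormedAddCommGroup X] [NormedSpace ℝ X] [CompleteSpace X]
  [NormedAddCommGroup Y] [NormedSpace ℝ Y]

/-- The global form of the inverse function theorem for injective maps. -/
theorem exists_openPartialHomeomorph_of_injOn {f : X → Y} {s : Set X} (hs : IsOpen s)
    (hinj : InjOn f s) (hf : ContDiffOn ℝ ∞ f s)
    (hd : ∀ x ∈ s, ∃ L : X ≃L[ℝ] Y, HasFDerivAt f (L : X →L[ℝ] Y) x) :
    ∃ e : OpenPartialHomeomorph X Y, e.source = s ∧ ⇑e = f ∧ ContDiffOn ℝ ∞ e.symm e.target := by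
  have hopen : IsOpenMap (s.domRestrict f) := by
    rw [isOpenMap_iff_nhds_le]
    rintro ⟨x, hx⟩
    obtain ⟨L, hL⟩ := hd x hx
    have h1 := (((hf.contDiffAt (hs.mem_nhds hx)).hasStrictFDerivAt' hL
      (by simp)).map_nhds_eq_of_equiv).ge
    rw [← hs.isOpenEmbedding_subtypeVal.map_nhds_eq ⟨x, hx⟩, Filter.map_map] at h1
    exact h1
  let e := OpenPartialHomeomorph.ofContinuousOpenRestrict hinj.bijOn_image.toPartialEquiv
    hf.continuousOn hopen hs
  refine ⟨e, rfl, rfl, fun y hy => ?_⟩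
  have hx : e.symm y ∈ s := e.map_target hy
  obtain ⟨L, hL⟩ := hd _ hx
  exact (e.contDiffAt_symm hy hL (hf.contDiffAt (hs.mem_nhds hx))).contDiffWithinAt

end InverseFunction

/-! ### Primitives, parity and sign in one variable. -/

section Primitive

theorem hasDerivAt_integral_of_contDiffOn {q : ℝ → ℝ} {s : Set ℝ} (hs : IsOpen s)
    (hs' : s.OrdConnected) (hq : ContDiffOn ℝ ∞ q s) {a x : ℝ} (ha : a ∈ s) (hx : x ∈ s) :
    HasDerivAt (fun x => ∫ t in a..x, q t) (q x) x := by
  refine intervalIntegral.integral_hasDerivAt_right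
    (hq.continuousOn.mono (hs'.uIcc_subset ha hx)).intervalIntegrable
    (hq.continuousOn.stronglyMeasurableAtFilter hs x hx)
    (hq.continuousOn.continuousAt (hs.mem_nhds hx))

theorem contDiffOn_integral {q : ℝ → ℝ} {s : Set ℝ} (hs : IsOpen s)
    (hs' : s.OrdConnected) (hq : ContDiffOn ℝ ∞ q s) {a : ℝ} (ha : a ∈ s) :
    ContDiffOn ℝ ∞ (fun x => ∫ t in a..x, q t) s :=
  (contDiffOn_infty_iff_deriv_of_isOpen hs).2 ⟨fun _ hx =>
    (hasDerivAt_integral_of_contDiffOn hs hs' hq ha hx).differentiableAt.differentiableWithinAt,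
    hq.congr fun _ hx => (hasDerivAt_integral_of_contDiffOn hs hs' hq ha hx).deriv⟩

/-- The integral of an odd function from `x` to `-x` is zero, so the base point `a` need not be `0`.
-/
theorem even_integral_of_odd {q : ℝ → ℝ} (hq : ContinuousOn q (Ioo (-1) 1))
    (hodd : ∀ x ∈ Ioo (-1 : ℝ) 1, q (-x) = -q x) {a : ℝ} (ha : a ∈ Ioo (-1 : ℝ) 1) :
    ∀ x ∈ Ioo (-1 : ℝ) 1, ∫ t in a..(-x), q t = ∫ t in a..x, q t := by
  intro x hx
  have hx' : -x ∈ Ioo (-1 : ℝ) 1 := ⟨by linarith [hx.2], by linarith [hx.1]⟩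
  have hint : ∀ b ∈ Ioo (-1 : ℝ) 1, ∀ c ∈ Ioo (-1 : ℝ) 1,
      IntervalIntegrable q MeasureTheory.volume b c := fun b hb c hc =>
    (hq.mono (ordConnected_Ioo.uIcc_subset hb hc)).intervalIntegrable
  have h1 : ∫ t in x..(-x), q t = 0 := by
    have h2 : ∫ t in x..(-x), q (-t) = ∫ t in x..(-x), -q t :=
      intervalIntegral.integral_congr fun t ht => hodd t (ordConnected_Ioo.uIcc_subset hx hx' ht)
    rw [intervalIntegral.integral_comp_neg, intervalIntegral.integral_neg, neg_neg] at h2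
    linarith
  rw [← intervalIntegral.integral_add_adjacent_intervals (hint a ha x hx) (hint x hx _ hx'), h1,
    add_zero]

theorem odd_dslope_of_even {g : ℝ → ℝ} (hg : ∀ x ∈ Ioo (-1 : ℝ) 1, g (-x) = g x) :
    ∀ x ∈ Ioo (-1 : ℝ) 1, dslope g 0 (-x) = -dslope g 0 x := by
  intro x hx
  rcases eq_or_ne x 0 with rfl | hx0
  · simp [deriv_zero_of_even hg]
  · rw [dslope_of_ne _ hx0, dslope_of_ne _ (neg_ne_zero.2 hx0), slope_def_field, slope_def_field,
      hg x hx, sub_zero, sub_zero, div_neg]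

theorem mul_dslope_of_zero {g : ℝ → ℝ} (hg : g 0 = 0) (x : ℝ) : x * dslope g 0 x = g x := by
  have := sub_smul_dslope g 0 x
  rwa [sub_zero, hg, sub_zero, smul_eq_mul] at this

theorem mul_pos_of_forall_ne_zero {f : ℝ → ℝ} {s : Set ℝ} (hs : s.OrdConnected)
    (hf : ContinuousOn f s) (hne : ∀ x ∈ s, f x ≠ 0) {x y : ℝ} (hx : x ∈ s) (hy : y ∈ s) :
    0 < f x * f y := by
  by_contra h
  have hsub := hs.uIcc_subset hx hy
  have h0 : (0 : ℝ) ∈ uIcc (f x) (f y) := by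
    rw [mem_uIcc]
    rcases lt_or_gt_of_ne (hne x hx) with h1 | h1 <;> rcases lt_or_gt_of_ne (hne y hy) with h2 | h2
    · exact absurd (mul_pos_of_neg_of_neg h1 h2) h
    · exact Or.inl ⟨h1.le, h2.le⟩
    · exact Or.inr ⟨h2.le, h1.le⟩
    · exact absurd (mul_pos h1 h2) h
  obtain ⟨z, hz, hz0⟩ := intermediate_value_uIcc (hf.mono hsub) h0
  exact hne z (hsub hz) hz0

end Primitive

/-! ### Derivative and trace of radial maps. -/

section RadialMaps

variable {n : ℕ} {g : ℝ → ℝ}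

theorem hasFDerivAt_smul_of_even (hd : DifferentiableOn ℝ g (Ioo (-1) 1))
    (hg : ∀ x ∈ Ioo (-1 : ℝ) 1, g (-x) = g x) {y : E n} (hy : y ∈ Metric.ball (0 : E n) 1) :
    HasFDerivAt (fun y : E n => g ‖y‖ • y) (g ‖y‖ • ContinuousLinearMap.id ℝ (E n) +
      (dslope (deriv g) 0 ‖y‖ • innerSL ℝ y).smulRight y) y :=
  (hasFDerivAt_comp_norm_of_even hd hg hy).smul (hasFDerivAt_id y)

theorem contDiffOn_smul_of_even (hs : ContDiffOn ℝ ∞ g (Ioo (-1) 1))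
    (hg : ∀ x ∈ Ioo (-1 : ℝ) 1, g (-x) = g x) :
    ContDiffOn ℝ ∞ (fun y : E n => g ‖y‖ • y) (Metric.ball 0 1) :=
  (contDiffOn_comp_norm_of_even hs hg).smul contDiffOn_id

theorem tr_smul_id_add_smulRight (c : ℝ) (l : E n →L[ℝ] ℝ) (y : E n) :
    tr n (c • ContinuousLinearMap.id ℝ (E n) + l.smulRight y) = c * n + l y := by
  rw [map_add, map_smul]
  have h1 : tr n (ContinuousLinearMap.id ℝ (E n)) = n := by
    change LinearMap.trace ℝ (E n) LinearMap.id = n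
    rw [LinearMap.trace_id]
    simp
  have h2 : tr n (l.smulRight y) = l y := by
    change LinearMap.trace ℝ (E n) ((l : E n →ₗ[ℝ] ℝ).smulRight y) = l y
    rw [LinearMap.trace_smulRight]
    rfl
  rw [h1, h2, smul_eq_mul]

/-- A rank-one perturbation of a scalar. Applying `l` to a kernel vector `v` gives `(c + l y) l v =
0`, hence `l v = 0` and then `c • v = 0`. -/
theorem exists_equiv_smul_id_add_smulRight {c : ℝ} (hc : c ≠ 0) (l : E n →L[ℝ] ℝ) {y : E n}
    (h : c + l y ≠ 0) : ∃ L : E n ≃L[ℝ] E n, (L : E n →L[ℝ] E n) =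
      c • ContinuousLinearMap.id ℝ (E n) + l.smulRight y := by
  set T : E n →L[ℝ] E n := c • ContinuousLinearMap.id ℝ (E n) + l.smulRight y with hT
  have hinj : Function.Injective (T : E n →ₗ[ℝ] E n) := by
    rw [← LinearMap.ker_eq_bot, LinearMap.ker_eq_bot']
    intro v hv
    have h1 : c • v + l v • y = 0 := hv
    have h2 : (c + l y) * l v = 0 := by
      have := congrArg l h1
      simp only [map_add, map_smul, map_zero, smul_eq_mul] at this
      linarith
    rw [(mul_eq_zero.1 h2).resolve_left h, zero_smul, add_zero] at h1
    exact (smul_eq_zero.1 h1).resolve_left hc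
  exact ⟨(LinearEquiv.ofInjectiveEndo _ hinj).toContinuousLinearEquiv, by ext1 v; rfl⟩

theorem divergence_radialField {f : ℝ → ℝ} (hd : DifferentiableOn ℝ f (Ioo (-1) 1))
    (hf : ∀ x ∈ Ioo (-1 : ℝ) 1, f (-x) = f x) {y : E 2} (hy : y ∈ disc) :
    divergence (radialField f) y = 2 * f ‖y‖ + deriv f ‖y‖ * ‖y‖ := by
  have h1 : fderiv ℝ (radialField f) y = _ := (hasFDerivAt_smul_of_even hd hf hy).fderiv
  rw [divergence, h1, tr_smul_id_add_smulRight, ← mul_dslope_deriv_of_even hf]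
  simp
  ring

end RadialMaps

/-! ### The case `f 0 ≠ 0`: solution of `(∗)` and linearization. -/

section NonvanishingAtZero

variable {f : ℝ → ℝ}

/-- For a radial function with profile `κ`, the equation reads `r f(r) κ'(r) = -N(r)`, where `N` is
the divergence minus `2 f 0`. The constant `R = 2 f 0` makes `N` vanish at `0`. So `N / (r f)` is
smooth and odd, and its primitive is smooth and even. -/
theorem isSolution_radialField (hf : ContDiffOn ℝ ∞ f (Ioo (-1) 1))
    (heven : ∀ x ∈ Ioo (-1 : ℝ) 1, f (-x) = f x) (hne : ∀ x ∈ Ioo (-1 : ℝ) 1, f x ≠ 0)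
    {r₀ : ℝ} (hr : r₀ ∈ Ioo (-1 : ℝ) 1) {G : E 2 → ℝ}
    (hG : ∀ y, G y = -∫ ρ in r₀..‖y‖, (2 * f ρ + deriv f ρ * ρ - 2 * f 0) / (f ρ * ρ)) :
    ContDiffOn ℝ ∞ G disc ∧ IsSolution disc (radialField f) (2 * f 0) (fun z => G z.1) := by
  have hd := (contDiffOn_infty_iff_deriv_of_isOpen isOpen_Ioo).1 hf
  set N : ℝ → ℝ := fun ρ => 2 * f ρ + deriv f ρ * ρ - 2 * f 0 with hN
  have hNs : ContDiffOn ℝ ∞ N (Ioo (-1) 1) :=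
    ((contDiffOn_const.mul hf).add (hd.2.mul contDiffOn_id)).sub contDiffOn_const
  have hN0 : N 0 = 0 := by simp [hN]
  have hNe : ∀ x ∈ Ioo (-1 : ℝ) 1, N (-x) = N x := fun x hx => by
    simp only [hN, heven x hx, deriv_neg_of_even heven hx]
    ring
  set q : ℝ → ℝ := fun ρ => dslope N 0 ρ / f ρ with hq
  have hqs : ContDiffOn ℝ ∞ q (Ioo (-1) 1) := (contDiffOn_dslope_zero hNs).div hf hne
  have hqo : ∀ x ∈ Ioo (-1 : ℝ) 1, q (-x) = -q x := fun x hx => by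
    simp only [hq, odd_dslope_of_even hNe x hx, heven x hx, neg_div]
  set κ : ℝ → ℝ := fun r => -∫ ρ in r₀..r, q ρ with hκ
  have hκs : ContDiffOn ℝ ∞ κ (Ioo (-1) 1) :=
    (contDiffOn_integral isOpen_Ioo ordConnected_Ioo hqs hr).neg
  have hκe : ∀ x ∈ Ioo (-1 : ℝ) 1, κ (-x) = κ x := fun x hx => by
    simp only [hκ, even_integral_of_odd hqs.continuousOn hqo hr x hx]
  have hκd : ∀ x ∈ Ioo (-1 : ℝ) 1, deriv κ x = -q x := fun x hx =>
    (hasDerivAt_integral_of_contDiffOn isOpen_Ioo ordConnected_Ioo hqs hr hx).neg.deriv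
  have hGκ : ∀ y ∈ Metric.ball (0 : E 2) 1, G y = κ ‖y‖ := fun y hy => by
    rw [hG]
    simp only [hκ]
    congr 1
    refine intervalIntegral.integral_congr fun x hx => ?_
    have hx' := ordConnected_Ioo.uIcc_subset hr (norm_mem_Ioo hy) hx
    change N x / (f x * x) = dslope N 0 x / f x
    rcases eq_or_ne x 0 with rfl | hx0
    -- At `x = 0` the integrand is `0` by the convention on division by zero; `dslope N 0 0` is the
    -- derivative at `0` of an even function, also `0`.
    · simp [deriv_zero_of_even hNe]
    · rw [← mul_dslope_of_zero hN0 x]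
      have := hne x hx'
      field_simp
  have hGs : ContDiffOn ℝ ∞ G disc := (contDiffOn_comp_norm_of_even hκs hκe).congr hGκ
  refine ⟨hGs, hGs.comp contDiff_fst.contDiffOn fun z hz => hz, fun z hz => ?_⟩
  have hz' : z.1 ∈ Metric.ball (0 : E 2) 1 := hz
  have h1 : HasFDerivAt G (dslope (deriv κ) 0 ‖z.1‖ • innerSL ℝ z.1) z.1 := by
    refine (hasFDerivAt_comp_norm_of_even (hκs.differentiableOn (by simp)) hκe
      hz').congr_of_eventuallyEq ?_
    filter_upwards [Metric.isOpen_ball.mem_nhds hz'] with y hy using hGκ y hy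
  have h2 := h1.comp z hasFDerivAt_fst
  have h3 : fderiv ℝ (fun z : BModel 2 => G z.1) z = _ := h2.fderiv
  have hr' := norm_mem_Ioo hz'
  have h4 : f ‖z.1‖ * q ‖z.1‖ = dslope N 0 ‖z.1‖ := mul_div_cancel₀ _ (hne _ hr')
  have h5 : ‖z.1‖ * dslope (deriv κ) 0 ‖z.1‖ = -q ‖z.1‖ := by
    rw [mul_dslope_deriv_of_even hκe, hκd _ hr']
  have h6 := mul_dslope_of_zero hN0 ‖z.1‖
  rw [h3, divergence_radialField hd.1 heven hz]
  simp [extendedField, radialField]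
  simp only [hN] at h6
  linear_combination f ‖z.1‖ * ‖z.1‖ * h5 - ‖z.1‖ * h4 - h6

/-- A smooth diffeomorphism that linearizes the radial vector field. -/
theorem exists_linearization_radialField (hf : ContDiffOn ℝ ∞ f (Ioo (-1) 1))
    (heven : ∀ x ∈ Ioo (-1 : ℝ) 1, f (-x) = f x) (hne : ∀ x ∈ Ioo (-1 : ℝ) 1, f x ≠ 0) :
    ∃ ψ ∈ contDiffGroupoid ∞ 𝓘(ℝ, E 2),
    ψ.source = disc ∧ ∀ y ∈ disc, fderiv ℝ ψ y (radialField f y) = f 0 • ψ y := by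
  have h0 : (0 : ℝ) ∈ Ioo (-1 : ℝ) 1 := by simp
  -- For `ψ y = g(r) y` the conjugacy equation is `(r g)' f = f(0) g`, that is `g' / g = m / r`. As
  -- `m 0 = 0`, the right side extends smoothly, and `g` is the exponential of its primitive.
  set m : ℝ → ℝ := fun x => f 0 / f x - 1 with hm
  have hms : ContDiffOn ℝ ∞ m (Ioo (-1) 1) := (contDiffOn_const.div hf hne).sub contDiffOn_const
  have hm0 : m 0 = 0 := by simp [hm, div_self (hne 0 h0)]
  have hme : ∀ x ∈ Ioo (-1 : ℝ) 1, m (-x) = m x := fun x hx => by simp only [hm, heven x hx]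
  have hqs := contDiffOn_dslope_zero hms
  set g : ℝ → ℝ := fun r => Real.exp (∫ ρ in (0 : ℝ)..r, dslope m 0 ρ) with hg
  have hgs : ContDiffOn ℝ ∞ g (Ioo (-1) 1) :=
    (contDiffOn_integral isOpen_Ioo ordConnected_Ioo hqs h0).exp
  have hge : ∀ x ∈ Ioo (-1 : ℝ) 1, g (-x) = g x := fun x hx => by
    simp only [hg, even_integral_of_odd hqs.continuousOn (odd_dslope_of_even hme) h0 x hx]
  have hgd : ∀ x ∈ Ioo (-1 : ℝ) 1, HasDerivAt g (g x * dslope m 0 x) x := fun x hx =>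
    (hasDerivAt_integral_of_contDiffOn isOpen_Ioo ordConnected_Ioo hqs h0 hx).exp
  have hgpos : ∀ x, 0 < g x := fun x => Real.exp_pos _
  have hkey : ∀ x ∈ Ioo (-1 : ℝ) 1, g x + x * deriv g x = g x * (f 0 / f x) := fun x hx => by
    rw [(hgd x hx).deriv]
    have := mul_dslope_of_zero hm0 x
    simp only [hm] at this
    linear_combination g x * this
  have hpos : ∀ x ∈ Ioo (-1 : ℝ) 1, 0 < f 0 / f x := fun x hx => by
    have := mul_pos_of_forall_ne_zero ordConnected_Ioo hf.continuousOn hne h0 hx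
    rw [← mul_div_mul_right _ _ (hne x hx)]
    exact div_pos this (mul_self_pos.2 (hne x hx))
  -- The radial profile `r g` of `ψ` has derivative `g f(0) / f > 0`; this gives injectivity of `ψ`,
  -- and below also invertibility of its derivative.
  have hmono : StrictMonoOn (fun x => x * g x) (Ioo (-1) 1) := by
    refine strictMonoOn_of_deriv_pos (convex_Ioo _ _)
      (continuousOn_id.mul hgs.continuousOn) fun x hx => ?_
    rw [interior_Ioo] at hx
    rw [((hasDerivAt_id' x).fun_mul (hgd x hx)).deriv, one_mul, ← (hgd x hx).deriv, hkey x hx]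
    exact mul_pos (hgpos x) (hpos x hx)
  have hd := hgs.differentiableOn (by simp)
  have hval : ∀ y : E 2, g ‖y‖ + (dslope (deriv g) 0 ‖y‖ • innerSL ℝ y) y =
      g ‖y‖ + ‖y‖ * deriv g ‖y‖ := fun y => by
    rw [← mul_dslope_deriv_of_even hge]
    simp
    ring
  obtain ⟨ψ, hψs, hψ, hψ'⟩ := exists_openPartialHomeomorph_of_injOn
    (f := fun y : E 2 => g ‖y‖ • y) (s := Metric.ball 0 1) Metric.isOpen_ball (by
      intro y hy y' hy' h
      have h1 : ‖y‖ * g ‖y‖ = ‖y'‖ * g ‖y'‖ := by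
        have h2 := congrArg norm h
        simp only [norm_smul, Real.norm_of_nonneg (hgpos _).le] at h2
        linarith
      have h2 : ‖y‖ = ‖y'‖ := hmono.injOn (norm_mem_Ioo hy) (norm_mem_Ioo hy') h1
      simp only [h2] at h
      exact smul_right_injective _ (hgpos ‖y'‖).ne' h)
    (contDiffOn_smul_of_even hgs hge) (by
      intro y hy
      obtain ⟨L, hL⟩ := exists_equiv_smul_id_add_smulRight (hgpos ‖y‖).ne'
        (dslope (deriv g) 0 ‖y‖ • innerSL ℝ y) (y := y) (by
          rw [hval, hkey _ (norm_mem_Ioo hy)]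
          exact (mul_pos (hgpos _) (hpos _ (norm_mem_Ioo hy))).ne')
      exact ⟨L, hL ▸ hasFDerivAt_smul_of_even hd hge hy⟩)
  refine ⟨ψ, mem_contDiffGroupoid_of_contDiffOn ?_ hψ', hψs, fun y hy => ?_⟩
  · rw [hψs, hψ]
    exact contDiffOn_smul_of_even hgs hge
  · have hy' := norm_mem_Ioo hy
    have h1 : (g ‖y‖ + (dslope (deriv g) 0 ‖y‖ • innerSL ℝ y) y) * f ‖y‖ = f 0 * g ‖y‖ := by
      have := hne _ hy'
      rw [hval, hkey _ hy']
      field_simp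
    rw [hψ, (hasFDerivAt_smul_of_even hd hge hy).fderiv, radialField, map_smul, smul_smul, ← h1,
      mul_comm _ (f ‖y‖), mul_smul, add_smul]
    rfl

/-- In the coordinate `ψ` the time-`t` flow map is the homothety of ratio `exp (f 0 * t)`, on which
`theta` vanishes. By the cocycle rule `theta ψ` then gives an invariant section. -/
theorem chernLosikClass_radialField_eq_zero (hf : ContDiffOn ℝ ∞ f (Ioo (-1) 1))
    (heven : ∀ x ∈ Ioo (-1 : ℝ) 1, f (-x) = f x) (hne : ∀ x ∈ Ioo (-1 : ℝ) 1, f x ≠ 0) :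
    chernLosikClass disc (radialField f) = 0 := by
  obtain ⟨ψ, hψ, hψs, hψV⟩ := exists_linearization_radialField hf heven hne
  refine chernLosikClass_eq_zero_of_section (g := theta ψ) (hψs ▸ contDiffOn_theta hψ)
    (fun y hy a c => theta_closed hψ (by rw [hψs]; exact hy) a c) fun φ hφ t ht y hy => ?_
  have hflow : ∀ w ∈ φ.source, w ∈ ψ.source ∧ φ w ∈ ψ.source ∧
      ψ (φ w) = Real.exp (f 0 * t) • ψ w := by
    intro w hw
    obtain ⟨γ, hγ0, hγt, hγU, hγ⟩ := ht w hw
    rw [← hγ0, hψs]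
    have hγt' : φ (γ 0) = γ t := by rw [hγ0, hγt]
    rw [hγt']
    refine ⟨hγU 0 left_mem_uIcc, hγU t right_mem_uIcc, ?_⟩
    -- The linearized curve solves `z' = f(0) z`, so after multiplication by `exp (-f(0) s)` it is
    -- constant.
    have hder : ∀ s ∈ uIcc 0 t,
        HasDerivWithinAt (fun s => Real.exp (-(f 0 * s)) • ψ (γ s)) 0 (uIcc 0 t) s := by
      intro s hs
      have h1 : HasFDerivAt ψ (fderiv ℝ ψ (γ s)) (γ s) :=
        ((contDiffAt_of_mem hψ (by rw [hψs]; exact hγU s hs)).differentiableAt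
          (by simp)).hasFDerivAt
      have h2 := h1.comp_hasDerivWithinAt s (hγ s hs)
      rw [hψV _ (hγU s hs)] at h2
      have h3 : HasDerivAt (fun s => Real.exp (-(f 0 * s)))
          (Real.exp (-(f 0 * s)) * -(f 0 * 1)) s := ((hasDerivAt_id' s).const_mul _).neg.exp
      refine (h3.hasDerivWithinAt.smul h2).congr_deriv ?_
      rw [Function.comp_apply, smul_smul, ← add_smul]
      simp
    have h4 := (convex_uIcc 0 t).norm_image_sub_le_of_norm_hasDerivWithin_le hder (C := 0)
      (by simp) left_mem_uIcc right_mem_uIcc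
    rw [zero_mul, norm_le_zero_iff, sub_eq_zero, mul_zero, neg_zero, Real.exp_zero, one_smul] at h4
    rw [← h4, smul_smul, ← Real.exp_add, add_neg_cancel, Real.exp_zero, one_smul]
  refine theta_comp_add_theta_of_eventuallyEq hψ hφ (A := (LinearEquiv.smulOfNeZero ℝ (E 2)
    (Real.exp (f 0 * t)) (Real.exp_pos _).ne').toContinuousLinearEquiv) hy (hflow y hy).1
    (hflow y hy).2.1 ?_
  filter_upwards [φ.open_source.mem_nhds hy] with w hw using (hflow w hw).2.2

end NonvanishingAtZero

/-! ### The plane of points `(x, p)` over the first axis. -/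

section Axis

/-- The first vector of the standard basis of the plane. -/
def axisVector : E 2 := EuclideanSpace.single 0 1

theorem norm_axisVector : ‖axisVector‖ = 1 := by simp [axisVector]

theorem inner_axisVector_self : inner ℝ axisVector axisVector = 1 := by simp [axisVector]

theorem norm_smul_axisVector {x : ℝ} (hx : 0 ≤ x) : ‖x • axisVector‖ = x := by
  rw [norm_smul, norm_axisVector, mul_one, Real.norm_of_nonneg hx]

theorem smul_axisVector_mem_disc {x : ℝ} (hx : x ∈ Ioo (-1 : ℝ) 1) : x • axisVector ∈ disc := by
  change x • axisVector ∈ Metric.ball (0 : E 2) 1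
  rw [mem_ball_zero_iff, norm_smul, norm_axisVector, mul_one]
  exact abs_lt.2 hx

/-- The points of `B` over the first coordinate axis, with covector along that axis. -/
def axis : ℝ × ℝ →L[ℝ] BModel 2 :=
  ((ContinuousLinearMap.fst ℝ ℝ ℝ).smulRight axisVector).prod
    ((ContinuousLinearMap.snd ℝ ℝ ℝ).smulRight (innerSL ℝ axisVector))

theorem axis_apply (x p : ℝ) : axis (x, p) = (x • axisVector, p • innerSL ℝ axisVector) := rfl

theorem axis_mem {x : ℝ} (hx : x ∈ Ioo (-1 : ℝ) 1) (p : ℝ) : axis (x, p) ∈ B disc :=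
  smul_axisVector_mem_disc hx

end Axis

/-! ### The case `f 0 = 0`: no solution of `(∗)`. -/

section VanishingAtZero

variable {f : ℝ → ℝ}

theorem Ioo_zero_one_subset : Ioo (0 : ℝ) 1 ⊆ Ioo (-1 : ℝ) 1 := Ioo_subset_Ioo_left (by norm_num)

theorem contDiffOn_radialDivergence (hf : ContDiffOn ℝ ∞ f (Ioo (-1) 1)) :
    ContDiffOn ℝ ∞ (fun x => 2 * f x + deriv f x * x) (Ioo (-1) 1) :=
  (contDiffOn_const.mul hf).add
    (((contDiffOn_infty_iff_deriv_of_isOpen isOpen_Ioo).1 hf).2.mul contDiffOn_id)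

theorem even_radialDivergence (heven : ∀ x ∈ Ioo (-1 : ℝ) 1, f (-x) = f x) :
    ∀ x ∈ Ioo (-1 : ℝ) 1, 2 * f (-x) + deriv f (-x) * -x = 2 * f x + deriv f x * x := by
  intro x hx
  rw [heven x hx, deriv_neg_of_even heven hx]
  ring

theorem fderiv_divergence_radialField (hf : ContDiffOn ℝ ∞ f (Ioo (-1) 1))
    (heven : ∀ x ∈ Ioo (-1 : ℝ) 1, f (-x) = f x) {y : E 2} (hy : y ∈ disc) :
    fderiv ℝ (divergence (radialField f)) y =
      dslope (deriv fun x => 2 * f x + deriv f x * x) 0 ‖y‖ • innerSL ℝ y := by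
  have h1 := hasFDerivAt_comp_norm_of_even
    ((contDiffOn_radialDivergence hf).differentiableOn (by simp)) (even_radialDivergence heven)
    (y := y) hy
  refine (h1.congr_of_eventuallyEq ?_).fderiv
  filter_upwards [disc.isOpen.mem_nhds hy] with w hw using
    divergence_radialField (hf.differentiableOn (by simp)) heven hw

theorem extendedField_radialField_zero (hf : ContDiffOn ℝ ∞ f (Ioo (-1) 1))
    (heven : ∀ x ∈ Ioo (-1 : ℝ) 1, f (-x) = f x) : extendedField (radialField f) 0 = 0 := by
  have h0 : (0 : E 2) ∈ disc := by simp [disc]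
  have h1 := fderiv_divergence_radialField hf heven h0
  rw [map_zero, smul_zero] at h1
  simp [extendedField, radialField, h1]

/-- The lifted field is tangent to the plane of points `(x, p)`, so the problem reduces to a planar
system there. -/
theorem extendedField_radialField_axis (hf : ContDiffOn ℝ ∞ f (Ioo (-1) 1))
    (heven : ∀ x ∈ Ioo (-1 : ℝ) 1, f (-x) = f x) {x : ℝ} (hx : x ∈ Ioo (0 : ℝ) 1) (p : ℝ) :
    extendedField (radialField f) (axis (x, p)) =
      axis (f x * x, deriv (fun x => 2 * f x + deriv f x * x) x - p * (f x + deriv f x * x)) := by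
  have hx1 := Ioo_zero_one_subset hx
  have hy := smul_axisVector_mem_disc hx1
  have hfd : fderiv ℝ (radialField f) (x • axisVector) = _ :=
    (hasFDerivAt_smul_of_even (hf.differentiableOn (by simp)) heven hy).fderiv
  rw [axis_apply, axis_apply, extendedField]
  simp only [fderiv_divergence_radialField hf heven hy, hfd, radialField,
    norm_smul_axisVector hx.1.le]
  rw [← mul_dslope_deriv_of_even (even_radialDivergence heven),
    ← mul_dslope_deriv_of_even heven]
  refine Prod.ext (smul_smul _ _ _) ?_
  ext v
  simp [norm_axisVector]
  ring

/-- Along the flow `x' = x f(x)` this logarithm grows at the rate of the divergence. `Real.log`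
depends on the absolute value only, so the sign of `f` plays no role. -/
theorem hasDerivAt_log_sq_mul (hf : ContDiffOn ℝ ∞ f (Ioo (-1) 1))
    {x : ℝ} (hx : x ∈ Ioo (0 : ℝ) 1) (hfx : f x ≠ 0) :
    HasDerivAt (fun x => Real.log (x ^ 2 * f x)) ((2 * f x + deriv f x * x) / (f x * x)) x := by
  have hx1 := Ioo_zero_one_subset hx
  have h1 : HasDerivAt f (deriv f x) x :=
    ((hf.differentiableOn (by simp) x hx1).differentiableAt (isOpen_Ioo.mem_nhds hx1)).hasDerivAt
  have hx0 := hx.1.ne'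
  refine (((hasDerivAt_pow 2 x).fun_mul h1).log (by positivity)).congr_deriv ?_
  field_simp
  push_cast
  ring

theorem tendsto_log_sq_mul (hf : ContDiffOn ℝ ∞ f (Ioo (-1) 1))
    (hne : ∀ x ∈ Ioo (0 : ℝ) 1, f x ≠ 0) :
    Filter.Tendsto (fun x => Real.log (x ^ 2 * f x)) (𝓝[>] 0) Filter.atBot := by
  have h0 : (0 : ℝ) ∈ Ioo (-1 : ℝ) 1 := by simp
  refine Real.tendsto_log_nhdsNE_zero.comp (tendsto_nhdsWithin_iff.2 ⟨?_, ?_⟩)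
  · have h1 : ContinuousAt (fun x => x ^ 2 * f x) 0 :=
      (continuousAt_id.pow 2).mul (hf.continuousOn.continuousAt (isOpen_Ioo.mem_nhds h0))
    have h2 := h1.tendsto
    simp only [ne_eq, OfNat.ofNat_ne_zero, not_false_eq_true, zero_pow, zero_mul] at h2
    exact h2.mono_left nhdsWithin_le_nhds
  · filter_upwards [Ioo_mem_nhdsGT (show (0 : ℝ) < 1 by norm_num)] with x hx
    exact mul_ne_zero (pow_ne_zero 2 hx.1.ne') (hne x hx)

theorem tendsto_radialDivergence (hf : ContDiffOn ℝ ∞ f (Ioo (-1) 1)) (h0 : f 0 = 0) :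
    Filter.Tendsto (fun x => 2 * f x + deriv f x * x) (𝓝 0) (𝓝 0) := by
  have h1 := (contDiffOn_radialDivergence hf).continuousOn.continuousAt
    (isOpen_Ioo.mem_nhds (show (0 : ℝ) ∈ Ioo (-1 : ℝ) 1 by simp))
  simpa [ContinuousAt, h0] using h1

/-- Along orbits of the lifted field in the plane, `G + log |x² f|` is constant. An orbit joining
`(x, 0)` to a point over `1 / 2` expresses the logarithm by values of `G`, which stay bounded as `x
→ 0`. -/
theorem not_isSolution_radialField (hf : ContDiffOn ℝ ∞ f (Ioo (-1) 1))
    (heven : ∀ x ∈ Ioo (-1 : ℝ) 1, f (-x) = f x) (hne : ∀ x ∈ Ioo (0 : ℝ) 1, f x ≠ 0)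
    (h0 : f 0 = 0) (R : ℝ) (G : BModel 2 → ℝ) : ¬ IsSolution disc (radialField f) R G := by
  rintro ⟨hG, hsol⟩
  have hGd : ∀ z ∈ B disc, DifferentiableAt ℝ G z := fun z hz =>
    (hG.contDiffAt ((B disc).isOpen.mem_nhds hz)).differentiableAt (by simp)
  have hz0 : (0 : BModel 2) ∈ B disc := by simp [B, disc]
  -- The lifted field vanishes at the origin of `B`, so the equation there says that `R` is the
  -- divergence `2 f 0`.
  have hR : R = 0 := by
    have h1 := hsol 0 hz0
    have h2 := divergence_radialField (f := f) (hf.differentiableOn (by simp)) heven (y := 0) hz0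
    rw [extendedField_radialField_zero hf heven, map_zero, Prod.fst_zero, h2] at h1
    simpa [h0, eq_comm] using h1
  subst hR
  set D : ℝ → ℝ := fun x => 2 * f x + deriv f x * x with hD
  -- The curves `p = (C + D x) / (f x * x)` are orbits, since `x f p - D` is a first integral of the
  -- lifted field.
  have hconst : ∀ C : ℝ, ∀ x ∈ Ioo (0 : ℝ) 1, ∀ x' ∈ Ioo (0 : ℝ) 1,
      G (axis (x, (C + D x) / (f x * x))) + Real.log (x ^ 2 * f x) =
        G (axis (x', (C + D x') / (f x' * x'))) + Real.log (x' ^ 2 * f x') := by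
    intro C x hx x' hx'
    have hder : ∀ x ∈ Ioo (0 : ℝ) 1, HasDerivAt
        (fun x => G (axis (x, (C + D x) / (f x * x))) + Real.log (x ^ 2 * f x)) 0 x := by
      intro x hx
      have hx1 := Ioo_zero_one_subset hx
      have hux : f x * x ≠ 0 := mul_ne_zero (hne x hx) hx.1.ne'
      have h1 : HasDerivAt f (deriv f x) x := ((hf.differentiableOn (by simp) x
        hx1).differentiableAt (isOpen_Ioo.mem_nhds hx1)).hasDerivAt
      have h2 : HasDerivAt D (deriv D x) x := (((contDiffOn_radialDivergence hf).differentiableOn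
        (by simp) x hx1).differentiableAt (isOpen_Ioo.mem_nhds hx1)).hasDerivAt
      have h3 := (h2.const_add C).fun_div (h1.fun_mul (hasDerivAt_id' x)) hux
      have h4 := axis.hasFDerivAt.comp_hasDerivAt x ((hasDerivAt_id' x).prodMk h3)
      have h5 := (hGd _ (axis_mem hx1 _)).hasFDerivAt.comp_hasDerivAt x h4
      refine (h5.add (hasDerivAt_log_sq_mul hf hx (hne x hx))).congr_deriv ?_
      have h6 := hsol _ (axis_mem hx1 ((C + D x) / (f x * x)))
      rw [extendedField_radialField_axis hf heven hx,
        divergence_radialField (hf.differentiableOn (by simp)) heven (axis_mem hx1 _), axis_apply,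
        norm_smul_axisVector hx.1.le, ← axis_apply] at h6
      -- The velocity of the curve, parametrized by `x`, is the lifted field divided by `f x * x`.
      have h7 : ((1 : ℝ), (deriv D x * (f x * x) - (C + D x) * (deriv f x * x + f x * 1)) /
          (f x * x) ^ 2) = (f x * x)⁻¹ • (f x * x,
            deriv D x - (C + D x) / (f x * x) * (f x + deriv f x * x)) := by
        refine Prod.ext (inv_mul_cancel₀ hux).symm ?_
        simp only [Prod.smul_snd, smul_eq_mul]
        have := hne x hx
        have := hx.1.ne'
        field_simp
        ring
      rw [h7, map_smul, map_smul, h6, smul_eq_mul]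
      field_simp
      ring
    have h := (convex_Ioo (0 : ℝ) 1).norm_image_sub_le_of_norm_hasDerivWithin_le
      (fun y hy => (hder y hy).hasDerivWithinAt) (C := 0) (by simp) hx' hx
    rwa [zero_mul, norm_le_zero_iff, sub_eq_zero] at h
  have hhalf : (1 / 2 : ℝ) ∈ Ioo (0 : ℝ) 1 := by norm_num
  have hkey : ∀ x ∈ Ioo (0 : ℝ) 1, Real.log (x ^ 2 * f x) =
      G (axis (1 / 2, (-D x + D (1 / 2)) / (f (1 / 2) * (1 / 2)))) +
        Real.log ((1 / 2) ^ 2 * f (1 / 2)) - G (axis (x, 0)) := by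
    intro x hx
    -- The choice `C = -D x` selects the orbit through `(x, 0)`.
    have := hconst (-D x) x hx _ hhalf
    rw [neg_add_cancel, zero_div] at this
    linarith
  have hDt : Filter.Tendsto D (𝓝[>] 0) (𝓝 0) :=
    (tendsto_radialDivergence hf h0).mono_left nhdsWithin_le_nhds
  have ht1 : Filter.Tendsto
      (fun x => G (axis (1 / 2, (-D x + D (1 / 2)) / (f (1 / 2) * (1 / 2))))) (𝓝[>] 0)
      (𝓝 (G (axis (1 / 2, (-0 + D (1 / 2)) / (f (1 / 2) * (1 / 2)))))) :=
    (((hGd _ (axis_mem (Ioo_zero_one_subset hhalf) _)).continuousAt.comp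
      axis.continuous.continuousAt).tendsto).comp
        (tendsto_const_nhds.prodMk_nhds ((hDt.neg.add_const _).div_const _))
  have ht2 : Filter.Tendsto (fun x : ℝ => G (axis (x, 0))) (𝓝[>] 0) (𝓝 (G (axis (0, 0)))) :=
    (((hGd _ (axis_mem (by simp) 0)).continuousAt.comp
      axis.continuous.continuousAt).tendsto).comp
        ((Filter.tendsto_id.mono_left nhdsWithin_le_nhds).prodMk_nhds tendsto_const_nhds)
  have ht3 := (ht1.add_const (Real.log ((1 / 2) ^ 2 * f (1 / 2)))).sub ht2
  refine not_tendsto_nhds_of_tendsto_atBot (tendsto_log_sq_mul hf hne) _ (ht3.congr' ?_)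
  filter_upwards [Ioo_mem_nhdsGT (show (0 : ℝ) < 1 by norm_num)] with x hx using (hkey x hx).symm

end VanishingAtZero

/-! ### The time coordinate of the radial flow. -/

section TimeFunction

/-- The time needed by the flow of the vector field `x ↦ x g(x)` on `(0, 1)`, as a coordinate. -/
theorem exists_timeFunction {g : ℝ → ℝ} (hg : ContDiffOn ℝ ∞ g (Ioo (-1) 1))
    (hpos : ∀ x ∈ Ioo (0 : ℝ) 1, 0 < g x) :
    ∃ F : OpenPartialHomeomorph ℝ ℝ, F.source = Ioo 0 1 ∧ ContDiffOn ℝ ∞ F (Ioo 0 1) ∧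
      ContDiffOn ℝ ∞ F.symm F.target ∧ StrictMonoOn F (Ioo 0 1) ∧
      (∀ x ∈ Ioo (0 : ℝ) 1, HasDerivAt F (g x * x)⁻¹ x) ∧
      ∀ x ∈ Ioo (0 : ℝ) 1, Iic (F x) ⊆ F.target := by
  have hhalf : (1 / 2 : ℝ) ∈ Ioo (0 : ℝ) 1 := by norm_num
  have hden : ∀ x ∈ Ioo (0 : ℝ) 1, 0 < g x * x := fun x hx => mul_pos (hpos x hx) hx.1
  have hq : ContDiffOn ℝ ∞ (fun x => (g x * x)⁻¹) (Ioo 0 1) :=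
    ((hg.mono Ioo_zero_one_subset).mul contDiffOn_id).inv fun x hx => (hden x hx).ne'
  set T : ℝ → ℝ := fun x => ∫ t in (1 / 2 : ℝ)..x, (g t * t)⁻¹ with hT
  have hTd : ∀ x ∈ Ioo (0 : ℝ) 1, HasDerivAt T (g x * x)⁻¹ x := fun x hx =>
    hasDerivAt_integral_of_contDiffOn isOpen_Ioo ordConnected_Ioo hq hhalf hx
  have hTs : ContDiffOn ℝ ∞ T (Ioo 0 1) :=
    contDiffOn_integral isOpen_Ioo ordConnected_Ioo hq hhalf
  have hmono : StrictMonoOn T (Ioo 0 1) := by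
    refine strictMonoOn_of_deriv_pos (convex_Ioo _ _) hTs.continuousOn fun x hx => ?_
    rw [interior_Ioo] at hx
    rw [(hTd x hx).deriv]
    exact inv_pos.2 (hden x hx)
  obtain ⟨F, hFs, hF, hF'⟩ := exists_openPartialHomeomorph_of_injOn isOpen_Ioo hmono.injOn hTs
    fun x hx => ⟨ContinuousLinearEquiv.unitsEquivAut ℝ
      (Units.mk0 _ (inv_pos.2 (hden x hx)).ne'), by
        refine (hTd x hx).hasFDerivAt.congr_fderiv ?_
        ext
        simp⟩
  -- The flow needs infinite time to reach `0`: a bound `g ≤ C` on `(0, 1/2]` gives `T' ≥ 1 / (C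
  -- x)`, so `T - C⁻¹ log x` is monotone and `T` tends to `-∞` with the logarithm.
  have hbot : ∀ v : ℝ, ∃ x ∈ Ioo (0 : ℝ) 1, T x ≤ v := by
    obtain ⟨C, hC⟩ := (isCompact_Icc (a := (0 : ℝ)) (b := 1 / 2)).exists_bound_of_continuousOn
      (hg.continuousOn.mono fun x hx => ⟨by linarith [hx.1], by linarith [hx.2]⟩)
    have hC0 : 0 < C := (hpos _ hhalf).trans_le
      ((le_abs_self _).trans (hC _ (right_mem_Icc.2 (by norm_num))))
    have hle : ∀ x ∈ Ioc (0 : ℝ) (1 / 2), T x - C⁻¹ * Real.log x ≤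
        T (1 / 2) - C⁻¹ * Real.log (1 / 2) := by
      have hsub : Ioc (0 : ℝ) (1 / 2) ⊆ Ioo 0 1 := fun x hx => ⟨hx.1, by linarith [hx.2]⟩
      have hd : ∀ x ∈ Ioc (0 : ℝ) (1 / 2), HasDerivAt (fun x => T x - C⁻¹ * Real.log x)
          ((g x * x)⁻¹ - C⁻¹ * x⁻¹) x := fun x hx =>
        (hTd x (hsub hx)).sub ((Real.hasDerivAt_log hx.1.ne').const_mul _)
      have hm : MonotoneOn (fun x => T x - C⁻¹ * Real.log x) (Ioc 0 (1 / 2)) := by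
        refine monotoneOn_of_deriv_nonneg (convex_Ioc _ _)
          (fun x hx => (hd x hx).continuousAt.continuousWithinAt)
          (fun x hx => (hd x (interior_subset hx)).differentiableAt.differentiableWithinAt)
          fun x hx => ?_
        have hx' := interior_subset hx
        rw [(hd x hx').deriv, mul_inv, sub_nonneg]
        have h1 : g x ≤ C := (le_abs_self _).trans (hC x ⟨hx'.1.le, hx'.2⟩)
        exact mul_le_mul_of_nonneg_right (inv_anti₀ (hpos x (hsub hx')) h1) (inv_pos.2 hx'.1).le
      intro x hx
      exact hm hx (right_mem_Ioc.2 (by norm_num)) hx.2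
    intro v
    have hlim : Filter.Tendsto (fun x => T (1 / 2) - C⁻¹ * Real.log (1 / 2) + C⁻¹ * Real.log x)
        (𝓝[>] 0) Filter.atBot :=
      Filter.tendsto_atBot_add_const_left _ _
        (Real.tendsto_log_nhdsGT_zero.const_mul_atBot (inv_pos.2 hC0))
    obtain ⟨x, hxv, hx⟩ := ((hlim.eventually (Filter.eventually_le_atBot v)).and
      (Ioc_mem_nhdsGT (show (0 : ℝ) < 1 / 2 by norm_num))).exists
    exact ⟨x, ⟨hx.1, by linarith [hx.2]⟩, by linarith [hle x hx]⟩
  refine ⟨F, hFs, hF ▸ hTs, hF', hF ▸ hmono, hF ▸ hTd, fun x hx v hv => ?_⟩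
  rw [hF] at hv
  obtain ⟨x', hx', hv'⟩ := hbot v
  have hsub := (ordConnected_Ioo (a := (0 : ℝ)) (b := 1)).uIcc_subset hx' hx
  obtain ⟨z, hz, rfl⟩ := intermediate_value_uIcc (hTs.continuousOn.mono hsub)
    (mem_uIcc.2 (Or.inl ⟨hv', hv⟩))
  have hzs : z ∈ F.source := by rw [hFs]; exact hsub hz
  have := F.map_source hzs
  rwa [hF] at this

end TimeFunction

/-! ### Radial local diffeomorphisms away from the origin. -/

section RadialHomeomorph

variable {n : ℕ}

theorem contDiffOn_div_norm_smul {h : ℝ → ℝ} {s : Set ℝ} (hs : IsOpen s) (hs0 : s ⊆ Ioi 0)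
    (hh : ContDiffOn ℝ ∞ h s) :
    ContDiffOn ℝ ∞ (fun y : E n => (h ‖y‖ / ‖y‖) • y) (norm ⁻¹' s) := by
  intro y hy
  have hy0 : y ≠ 0 := norm_pos_iff.1 (hs0 hy)
  have h1 : ContDiffAt ℝ ∞ (norm : E n → ℝ) y := contDiffAt_norm ℝ hy0
  have h2 : ContDiffAt ℝ ∞ (fun y : E n => h ‖y‖) y :=
    (hh.contDiffAt (hs.mem_nhds hy)).comp y h1
  exact ((h2.div h1 (norm_ne_zero_iff.2 hy0)).smul contDiffAt_id).contDiffWithinAt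

theorem norm_div_norm_smul {c : ℝ} (hc : 0 < c) {y : E n} (hy : 0 < ‖y‖) :
    ‖(c / ‖y‖) • y‖ = c := by
  rw [norm_smul, Real.norm_of_nonneg (div_pos hc hy).le, div_mul_cancel₀ _ hy.ne']

/-- The radial local diffeomorphism defined by a local diffeomorphism of the half-line. -/
def radialHomeomorph (n : ℕ) (e : OpenPartialHomeomorph ℝ ℝ) (hs : e.source ⊆ Ioi 0)
    (ht : e.target ⊆ Ioi 0) (he : ContDiffOn ℝ ∞ e e.source)
    (he' : ContDiffOn ℝ ∞ e.symm e.target) : OpenPartialHomeomorph (E n) (E n) where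
  toFun y := (e ‖y‖ / ‖y‖) • y
  invFun y := (e.symm ‖y‖ / ‖y‖) • y
  source := norm ⁻¹' e.source
  target := norm ⁻¹' e.target
  map_source' y hy := by
    rw [mem_preimage, norm_div_norm_smul (ht (e.map_source hy)) (hs hy)]
    exact e.map_source hy
  map_target' y hy := by
    rw [mem_preimage, norm_div_norm_smul (hs (e.map_target hy)) (ht hy)]
    exact e.map_target hy
  left_inv' y hy := by
    have h1 : 0 < ‖y‖ := hs hy
    have h2 : 0 < e ‖y‖ := ht (e.map_source hy)
    rw [norm_div_norm_smul h2 h1, e.left_inv hy, smul_smul, div_mul_div_cancel₀ h2.ne',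
      div_self h1.ne', one_smul]
  right_inv' y hy := by
    have h1 : 0 < ‖y‖ := ht hy
    have h2 : 0 < e.symm ‖y‖ := hs (e.map_target hy)
    rw [norm_div_norm_smul h2 h1, e.right_inv hy, smul_smul, div_mul_div_cancel₀ h2.ne',
      div_self h1.ne', one_smul]
  open_source := e.open_source.preimage continuous_norm
  open_target := e.open_target.preimage continuous_norm
  continuousOn_toFun := (contDiffOn_div_norm_smul e.open_source hs he).continuousOn
  continuousOn_invFun := (contDiffOn_div_norm_smul e.open_target ht he').continuousOn

variable {e : OpenPartialHomeomorph ℝ ℝ} {hs : e.source ⊆ Ioi 0}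
    {ht : e.target ⊆ Ioi 0} {he : ContDiffOn ℝ ∞ e e.source}
    {he' : ContDiffOn ℝ ∞ e.symm e.target}

theorem radialHomeomorph_mem : radialHomeomorph n e hs ht he he' ∈ contDiffGroupoid ∞ 𝓘(ℝ, E n) :=
  mem_contDiffGroupoid_of_contDiffOn (contDiffOn_div_norm_smul e.open_source hs he)
    (contDiffOn_div_norm_smul e.open_target ht he')

theorem radialHomeomorph_apply (y : E n) :
    radialHomeomorph n e hs ht he he' y = (e ‖y‖ / ‖y‖) • y := rfl

theorem fderiv_radialHomeomorph {y : E n} (hy : ‖y‖ ∈ e.source) (v : E n) :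
    fderiv ℝ (radialHomeomorph n e hs ht he he') y v =
      (e ‖y‖ / ‖y‖) • v + (deriv (fun x => e x / x) ‖y‖ * ‖y‖⁻¹ * inner ℝ y v) • y := by
  have hy0 : 0 < ‖y‖ := hs hy
  have h2 : HasFDerivAt (fun y : E n => ‖y‖) (‖y‖⁻¹ • innerSL ℝ y) y := by
    have h3 := ((hasStrictFDerivAt_norm_sq y).hasFDerivAt).sqrt (by simpa using norm_pos_iff.1 hy0)
    simp only [Real.sqrt_sq (norm_nonneg _)] at h3
    refine h3.congr_fderiv ?_
    ext v
    simp
    ring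
  have h1 : HasDerivAt (fun x => e x / x) (deriv (fun x => e x / x) ‖y‖) ‖y‖ :=
    (((he.contDiffAt (e.open_source.mem_nhds hy)).differentiableAt (by simp)).div
      differentiableAt_id hy0.ne').hasDerivAt
  have h4 : HasFDerivAt (radialHomeomorph n e hs ht he he') _ y :=
    (h1.comp_hasFDerivAt y h2).fun_smul (hasFDerivAt_id y)
  rw [h4.fderiv]
  simp [mul_assoc]

end RadialHomeomorph

/-! ### Lifts of radial maps over the axis. -/

section AxisLift

/-- The second vector of the standard basis of the plane. -/
def transverseVector : E 2 := EuclideanSpace.single 1 1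

theorem inner_axisVector_transverseVector : inner ℝ axisVector transverseVector = 0 := by
  rw [axisVector, EuclideanSpace.inner_single_left, transverseVector]
  simp

theorem tr_two_apply (T : E 2 →L[ℝ] E 2) :
    tr 2 T = inner ℝ axisVector (T axisVector) + inner ℝ transverseVector (T transverseVector) := by
  have h := LinearMap.trace_eq_sum_inner (T : E 2 →ₗ[ℝ] E 2) (EuclideanSpace.basisFun (Fin 2) ℝ)
  rw [Fin.sum_univ_two, EuclideanSpace.basisFun_apply, EuclideanSpace.basisFun_apply] at h
  exact h

theorem covector_ext {l m : E 2 →L[ℝ] ℝ} (h1 : l axisVector = m axisVector)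
    (h2 : l transverseVector = m transverseVector) : l = m := by
  ext v
  have hv : v = v 0 • axisVector + v 1 • transverseVector := by
    ext i
    fin_cases i <;> simp [axisVector, transverseVector]
  rw [hv]
  simp only [map_add, map_smul, h1, h2]

variable {e : OpenPartialHomeomorph ℝ ℝ} {hs : e.source ⊆ Ioi 0}
    {ht : e.target ⊆ Ioi 0} {he : ContDiffOn ℝ ∞ e e.source}
    {he' : ContDiffOn ℝ ∞ e.symm e.target}

theorem smul_axisVector_mem_source {x : ℝ} (hx : x ∈ e.source) :
    x • axisVector ∈ (radialHomeomorph 2 e hs ht he he').source := by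
  change ‖x • axisVector‖ ∈ e.source
  rwa [norm_smul_axisVector (hs hx).le]

theorem radialHomeomorph_smul_axisVector {x : ℝ} (hx : x ∈ e.source) :
    radialHomeomorph 2 e hs ht he he' (x • axisVector) = e x • axisVector := by
  have h0 : 0 < x := hs hx
  rw [radialHomeomorph_apply, norm_smul_axisVector h0.le, smul_smul, div_mul_cancel₀ _ h0.ne']

theorem fderiv_radialHomeomorph_axisVector {x : ℝ} (hx : x ∈ e.source) :
    fderiv ℝ (radialHomeomorph 2 e hs ht he he') (x • axisVector) axisVector =
      deriv e x • axisVector := by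
  have h1 := ((contDiffAt_of_mem radialHomeomorph_mem
    (smul_axisVector_mem_source (hs := hs) (ht := ht) (he := he) (he' := he')
      hx)).differentiableAt (by simp)).hasFDerivAt
  have h2 := h1.comp_hasDerivAt x ((hasDerivAt_id' x).smul_const axisVector)
  have h3 : HasDerivAt (fun x => e x • axisVector) (deriv e x • axisVector) x :=
    (((he.contDiffAt (e.open_source.mem_nhds hx)).differentiableAt
      (by simp)).hasDerivAt).smul_const axisVector
  rw [one_smul] at h2
  refine h2.unique (h3.congr_of_eventuallyEq ?_)
  filter_upwards [e.open_source.mem_nhds hx] with w hw using radialHomeomorph_smul_axisVector hw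

theorem fderiv_radialHomeomorph_transverseVector {x : ℝ} (hx : x ∈ e.source) :
    fderiv ℝ (radialHomeomorph 2 e hs ht he he') (x • axisVector) transverseVector =
      (e x / x) • transverseVector := by
  have h0 : 0 < x := hs hx
  rw [fderiv_radialHomeomorph (by rwa [norm_smul_axisVector h0.le]), norm_smul_axisVector h0.le,
    real_inner_smul_left, inner_axisVector_transverseVector]
  simp

theorem fderiv_fderiv_apply_of_eventually {n : ℕ} {α : OpenPartialHomeomorph (E n) (E n)}
    (hα : α ∈ contDiffGroupoid ∞ 𝓘(ℝ, E n)) {a v : E n} {x : ℝ} (hx : x • a ∈ α.source)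
    {k : ℝ → ℝ} {k' : ℝ} (hk : HasDerivAt k k' x)
    (hv : ∀ᶠ w in 𝓝 x, fderiv ℝ α (w • a) v = k w • v) :
    fderiv ℝ (fderiv ℝ α) (x • a) a v = k' • v := by
  have h1 := ((contDiffAt_fderiv hα hx).differentiableAt (by simp)).hasFDerivAt
  have h2 : HasDerivAt (fun w : ℝ => w • a) a x := by
    simpa using (hasDerivAt_id' x).smul_const a
  have h3 : HasDerivAt (fun w : ℝ => fderiv ℝ α (w • a)) (fderiv ℝ (fderiv ℝ α) (x • a) a) x :=
    h1.comp_hasDerivAt x h2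
  have h4 : HasDerivAt (fun w : ℝ => fderiv ℝ α (w • a) v)
      (fderiv ℝ (fderiv ℝ α) (x • a) a v) x := by
    simpa using h3.clm_apply (hasDerivAt_const x v)
  exact h4.unique ((hk.smul_const v).congr_of_eventuallyEq hv)

theorem deriv_ne_zero_of_source {x : ℝ} (hx : x ∈ e.source) (he : ContDiffOn ℝ ∞ e e.source)
    (he' : ContDiffOn ℝ ∞ e.symm e.target) : deriv e x ≠ 0 := by
  have h1 := ((he.contDiffAt (e.open_source.mem_nhds hx)).differentiableAt (by simp)).hasDerivAt
  have h2 := ((he'.contDiffAt (e.open_target.mem_nhds (e.map_source hx))).differentiableAt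
    (by simp)).hasDerivAt
  have h3 := (h2.comp x h1).unique ((hasDerivAt_id x).congr_of_eventuallyEq (by
    filter_upwards [e.open_source.mem_nhds hx] with w hw using e.left_inv hw))
  intro h
  rw [h, mul_zero] at h3
  exact zero_ne_one h3

theorem invDeriv_apply_of_fderiv {n : ℕ} {α : OpenPartialHomeomorph (E n) (E n)}
    (hα : α ∈ contDiffGroupoid ∞ 𝓘(ℝ, E n)) {y : E n} (hy : y ∈ α.source) {c : ℝ} {v : E n}
    (hv : fderiv ℝ α y v = c • v) (hc : c ≠ 0) : invDeriv α y v = c⁻¹ • v := by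
  have h := congrArg (fun L : E n →L[ℝ] E n => L v) (invDeriv_comp hα hy)
  simp only [ContinuousLinearMap.comp_apply, hv, map_smul, ContinuousLinearMap.id_apply] at h
  rw [← h, smul_smul, inv_mul_cancel₀ hc, one_smul, h]

/-- Here `theta` is the derivative of `log |det|`, and on the axis the derivative of the radial map
is diagonal, with radial entry `e'(x)` and transverse entry `e(x) / x`. -/
theorem hasDerivAt_log_deriv_mul_div {x : ℝ} (hx : x ∈ e.source) :
    HasDerivAt (fun x => Real.log (deriv e x * (e x / x)))
      (theta (radialHomeomorph 2 e hs ht he he') (x • axisVector) axisVector) x := by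
  have h0 : 0 < x := hs hx
  have hex : 0 < e x := ht (e.map_source hx)
  have hsrc := smul_axisVector_mem_source (hs := hs) (ht := ht) (he := he) (he' := he') hx
  have hd1 : HasDerivAt (deriv e) (deriv (deriv e) x) x :=
    ((((contDiffOn_infty_iff_deriv_of_isOpen e.open_source).1 he).2.contDiffAt
      (e.open_source.mem_nhds hx)).differentiableAt (by simp)).hasDerivAt
  have hd2 : HasDerivAt (fun x => e x / x) (deriv (fun x => e x / x) x) x :=
    (((he.contDiffAt (e.open_source.mem_nhds hx)).differentiableAt (by simp)).div
      differentiableAt_id h0.ne').hasDerivAt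
  have hne1 := deriv_ne_zero_of_source hx he he'
  have hne2 : e x / x ≠ 0 := (div_pos hex h0).ne'
  refine ((hd1.fun_mul hd2).log (mul_ne_zero hne1 hne2)).congr_deriv ?_
  rw [theta_apply, tr_two_apply, ContinuousLinearMap.comp_apply, ContinuousLinearMap.comp_apply,
    fderiv_fderiv_apply_of_eventually radialHomeomorph_mem hsrc hd1 (by
      filter_upwards [e.open_source.mem_nhds hx] with w hw using
        fderiv_radialHomeomorph_axisVector hw),
    fderiv_fderiv_apply_of_eventually radialHomeomorph_mem hsrc hd2 (by
      filter_upwards [e.open_source.mem_nhds hx] with w hw using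
        fderiv_radialHomeomorph_transverseVector hw), map_smul, map_smul,
    invDeriv_apply_of_fderiv radialHomeomorph_mem hsrc (fderiv_radialHomeomorph_axisVector hx) hne1,
    invDeriv_apply_of_fderiv radialHomeomorph_mem hsrc
      (fderiv_radialHomeomorph_transverseVector hx) hne2]
  have h1 : inner ℝ transverseVector transverseVector = (1 : ℝ) := by simp [transverseVector]
  simp only [inner_smul_right, inner_axisVector_self, h1]
  field_simp

/-- The reflection in the axis commutes with the radial map, fixes the points of the axis and
reverses the transverse vector. -/
theorem theta_radialHomeomorph_transverseVector {x : ℝ} (hx : x ∈ e.source) :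
    theta (radialHomeomorph 2 e hs ht he he') (x • axisVector) transverseVector = 0 := by
  set A := (ℝ ∙ axisVector).reflection with hA
  have h1 : A (x • axisVector) = x • axisVector :=
    Submodule.reflection_mem_subspace_eq_self (Submodule.smul_mem _ _
      (Submodule.mem_span_singleton_self _))
  have h2 : A transverseVector = -transverseVector := by
    refine Submodule.reflection_mem_subspace_orthogonalComplement_eq_neg ?_
    rw [Submodule.mem_orthogonal_singleton_iff_inner_right]
    exact inner_axisVector_transverseVector
  have h3 := theta_apply_of_commute (A := A.toContinuousLinearEquiv) radialHomeomorph_mem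
    (smul_axisVector_mem_source (hs := hs) (ht := ht) (he := he) (he' := he') hx) h1
    (Filter.Eventually.of_forall fun w => by
      change _ = A _
      rw [radialHomeomorph_apply, radialHomeomorph_apply, map_smul]
      change (e ‖A w‖ / ‖A w‖) • A w = _
      rw [LinearIsometryEquiv.norm_map]) transverseVector
  have h4 : A.toContinuousLinearEquiv transverseVector = -transverseVector := h2
  rw [h4, map_neg] at h3
  linarith

theorem lift_radialHomeomorph_axis {x : ℝ} (hx : x ∈ e.source) (p : ℝ) :
    lift (radialHomeomorph 2 e hs ht he he') (axis (x, p)) =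
      axis (e x, (theta (radialHomeomorph 2 e hs ht he he') (x • axisVector) axisVector + p) /
        deriv e x) := by
  have hsrc := smul_axisVector_mem_source (hs := hs) (ht := ht) (he := he) (he' := he') hx
  have h0 : 0 < x := hs hx
  have hex : 0 < e x := ht (e.map_source hx)
  have h1 := lift_snd_comp (z := axis (x, p)) radialHomeomorph_mem hsrc axisVector
  have h2 := lift_snd_comp (z := axis (x, p)) radialHomeomorph_mem hsrc transverseVector
  rw [axis_apply] at h1 h2
  rw [axis_apply]
  rw [fderiv_radialHomeomorph_axisVector hx, map_smul, smul_eq_mul, mul_comm] at h1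
  rw [fderiv_radialHomeomorph_transverseVector hx, map_smul, smul_eq_mul, mul_comm] at h2
  simp only [_root_.add_apply, _root_.smul_apply, innerSL_apply_apply, inner_axisVector_self,
    inner_axisVector_transverseVector, theta_radialHomeomorph_transverseVector hx, smul_eq_mul,
    mul_one, mul_zero, add_zero] at h1 h2
  have h3 := radialHomeomorph_smul_axisVector (hs := hs) (ht := ht) (he := he) (he' := he') hx
  refine Prod.ext h3 (covector_ext ?_ ?_)
  · rw [eq_div_of_mul_eq (deriv_ne_zero_of_source hx he he') h1, axis_apply]
    simp [norm_axisVector]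
  · rw [(mul_eq_zero.1 h2).resolve_right (div_pos hex h0).ne', axis_apply]
    simp [inner_axisVector_transverseVector]

end AxisLift

/-! ### From an invariant primitive to a function on `B`. -/

section Primitive

theorem contDiff_ofSubsingletonLIE_symm {W : Type} [NormedAddCommGroup W] [NormedSpace ℝ W] :
    ContDiff ℝ ∞ (ContinuousAlternatingMap.ofSubsingletonLIE (𝕜 := ℝ) (E := W) (F := ℝ)
      (0 : Fin 1)).symm :=
  LinearIsometryEquiv.contDiff _

theorem exists_hasFDerivAt_sub_of_symmetric {W : Type} [NormedAddCommGroup W] [NormedSpace ℝ W]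
    {s : Set W} (hs : IsOpen s) (hc : Convex ℝ s) {L M : W → W →L[ℝ] ℝ}
    (hL : ∀ z ∈ s, DifferentiableAt ℝ L z) (hM : ∀ z ∈ s, DifferentiableAt ℝ M z)
    (hsymm : ∀ z ∈ s, ∀ v w, fderiv ℝ L z v w - fderiv ℝ L z w v =
      fderiv ℝ M z v w - fderiv ℝ M z w v) :
    ∃ G : W → ℝ, ∀ z ∈ s, HasFDerivAt G (L z - M z) z := by
  obtain ⟨G, hG⟩ := hc.exists_forall_hasFDerivWithinAt_of_hasFDerivWithinAt_symmetric
    (fun z hz => ((hL z hz).hasFDerivAt.fun_sub (hM z hz).hasFDerivAt).hasFDerivWithinAt)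
    (fun z hz v _ w _ => by
      have := hsymm z hz v w
      simp only [sub_apply]
      linarith)
  exact ⟨G, fun z hz => (hG z hz).hasFDerivAt (hs.mem_nhds hz)⟩

variable {n : ℕ} {U : TopologicalSpace.Opens (E n)} {V : E n → E n}

theorem differentiableAt_lift {α : OpenPartialHomeomorph (E n) (E n)}
    (hα : α ∈ contDiffGroupoid ∞ 𝓘(ℝ, E n)) {z : BModel n} (hz : z.1 ∈ α.source) :
    DifferentiableAt ℝ (lift α) z := by
  have h1 : DifferentiableAt ℝ (fun z : BModel n => α z.1) z :=
    DifferentiableAt.comp z (g := α) ((contDiffAt_of_mem hα hz).differentiableAt (by simp))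
      differentiableAt_fst
  exact h1.prodMk (differentiableAt_lift_snd hα hz)

/-- If the first Chern–Losik class vanishes, then the difference of an invariant primitive of the
symplectic form and the tautological form is the differential of a function, which changes
under the lift of `α` by a primitive of `-theta α`. -/
theorem exists_primitive_of_chernLosikClass_eq_zero (hU : Convex ℝ (U : Set (E n)))
    (h : chernLosikClass U V = 0) : ∃ G : BModel n → ℝ, (∀ z ∈ B U, DifferentiableAt ℝ G z) ∧
      ∀ α ∈ flowPseudogroup U V, α.source ⊆ U → ∀ z : BModel n, z.1 ∈ α.source → α z.1 ∈ U →
        HasFDerivAt (fun z => G (lift α z) - G z)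
          (-(theta α z.1 ∘L ContinuousLinearMap.fst ℝ (E n) (E n →L[ℝ] ℝ))) z := by
  obtain ⟨η, ⟨hη, hinv⟩, hdη⟩ := chernLosikClass_eq_zero_iff.1 h
  set ι := ContinuousAlternatingMap.ofSubsingletonLIE (𝕜 := ℝ) (E := BModel n) (F := ℝ)
    (0 : Fin 1) with hι
  set L : BModel n → BModel n →L[ℝ] ℝ := fun z => ι.symm (η z) with hL
  have hηL : η = fun z => ι (L z) := funext fun z => (ι.apply_symm_apply _).symm
  have hLapp : ∀ z v, η z v = L z (v 0) := fun z v => by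
    rw [hηL, hι]
    simp
  have hLs : ContDiffOn ℝ ∞ L (B U) := contDiff_ofSubsingletonLIE_symm.comp_contDiffOn hη
  have hLd : ∀ z ∈ B U, DifferentiableAt ℝ L z := fun z hz =>
    (hLs.contDiffAt ((B U).isOpen.mem_nhds hz)).differentiableAt (by simp)
  have hsymm : ∀ z ∈ B U, ∀ v w : BModel n,
      fderiv ℝ L z v w - fderiv ℝ L z w v = v.2 w.1 - w.2 v.1 := by
    intro z hz v w
    have h1 := hdη z hz
    rw [hηL] at h1
    have h2 := extDeriv_ofSubsingleton_apply (hLd z hz) ![v, w]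
    rw [h1, symplectic_apply] at h2
    simpa using h2.symm
  have hBconv : Convex ℝ (B U : Set (BModel n)) :=
    hU.linear_preimage (LinearMap.fst ℝ (E n) (E n →L[ℝ] ℝ))
  set τ : BModel n → BModel n →L[ℝ] ℝ := tautologicalAdd (0 : E n → E n →L[ℝ] ℝ) with hτ
  have hτapp : ∀ z v, τ z v = z.2 v.1 := fun z v => by simp [hτ, tautologicalAdd]
  have hτd : ∀ z, DifferentiableAt ℝ τ z ∧ ∀ v w, fderiv ℝ τ z v w = v.2 w.1 := fun z => by
    have h1 : HasFDerivAt τ _ z := ((hasFDerivAt_snd (𝕜 := ℝ) (p := z)).add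
      (hasFDerivAt_const (0 : E n →L[ℝ] ℝ) z)).clm_comp
        (hasFDerivAt_const (ContinuousLinearMap.fst ℝ (E n) (E n →L[ℝ] ℝ)) z)
    refine ⟨h1.differentiableAt, fun v w => ?_⟩
    rw [h1.fderiv]
    simp
  obtain ⟨G, hG'⟩ := exists_hasFDerivAt_sub_of_symmetric (B U).isOpen hBconv hLd
    (fun z _ => (hτd z).1) fun z hz v w => by
      rw [(hτd z).2, (hτd z).2]
      exact hsymm z hz v w
  refine ⟨G, fun z hz => (hG' z hz).differentiableAt, fun α hα hαU z hz hαz => ?_⟩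
  have hα' := flowPseudogroup_le U V hα
  have h1 := (hG' (lift α z) hαz).comp z (differentiableAt_lift hα' hz).hasFDerivAt
  refine (h1.sub (hG' z (hαU hz))).congr_fderiv (ContinuousLinearMap.ext fun v => ?_)
  have h2 : L (lift α z) (fderiv ℝ (lift α) z v) = L z v := by
    have h3 := congrArg (fun ξ : BModel n [⋀^Fin 1]→L[ℝ] ℝ => ξ fun _ => v)
      (hinv _ ⟨α, hα, hαU, rfl⟩ z hz)
    simpa [hLapp] using h3
  have h4 := lift_snd_comp hα' hz v.1
  have h5 : (fderiv ℝ (lift α) z v).1 = fderiv ℝ α z.1 v.1 := by rw [fderiv_lift hα' hz]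
  -- The invariance of `η` cancels the two terms in `L`; the tautological form fails to be invariant
  -- exactly by `theta α`.
  change L (lift α z) (fderiv ℝ (lift α) z v) - τ (lift α z) (fderiv ℝ (lift α) z v) -
    (L z v - τ z v) = -theta α z.1 v.1
  rw [h2, hτapp, hτapp, h5, h4, add_apply]
  ring

end Primitive

/-! ### The case `f 0 = 0`: the class does not vanish. -/

section Contraction

variable {f : ℝ → ℝ}

theorem mem_flowPseudogroup {n : ℕ} {U : TopologicalSpace.Opens (E n)} {V : E n → E n}
    {φ : OpenPartialHomeomorph (E n) (E n)} (hφ : φ ∈ contDiffGroupoid ∞ 𝓘(ℝ, E n)) {t : ℝ}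
    (ht : IsFlowMap U V t φ) : φ ∈ flowPseudogroup U V :=
  mem_iInter₂.2 fun _ hP => hP φ hφ t ht

/-- The lift to `B` of a contracting time-one map of the flow of a radial vector field, along the
axis. -/
theorem exists_contraction (hf : ContDiffOn ℝ ∞ f (Ioo (-1) 1))
    (hne : ∀ x ∈ Ioo (0 : ℝ) 1, f x ≠ 0) :
    ∃ φ ∈ flowPseudogroup disc (radialField f), ∃ h θ F F' : ℝ → ℝ,
      φ.source ⊆ disc ∧
      (∀ x ∈ Ioo (0 : ℝ) 1, x • axisVector ∈ φ.source ∧ φ (x • axisVector) ∈ disc) ∧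
      (∀ x ∈ Ioo (0 : ℝ) 1, h x ∈ Ioo 0 x) ∧
      (∀ x ∈ Ioo (0 : ℝ) 1, HasDerivAt F (F' x) x ∧ |F' x| = |(f x * x)⁻¹|) ∧
      StrictMonoOn F (Ioo 0 1) ∧ (∀ x ∈ Ioo (0 : ℝ) 1, F (h x) = F x - 1) ∧
      (∀ x ∈ Ioo (0 : ℝ) 1, HasDerivAt h (f (h x) * h x / (f x * x)) x) ∧
      (∀ x ∈ Ioo (0 : ℝ) 1, theta φ (x • axisVector) axisVector = θ x) ∧
      (∀ x ∈ Ioo (0 : ℝ) 1, HasDerivAt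
        (fun x => Real.log (h x ^ 2 * f (h x)) - Real.log (x ^ 2 * f x)) (θ x) x) ∧
      ∀ x ∈ Ioo (0 : ℝ) 1, ∀ p : ℝ,
        lift φ (axis (x, p)) = axis (h x, (θ x + p) / (f (h x) * h x / (f x * x))) := by
  have hhalf : (1 / 2 : ℝ) ∈ Ioo (0 : ℝ) 1 := by norm_num
  -- `ε` is the constant sign of `f` on `(0, 1)`, so the field `ε f` points outwards.
  obtain ⟨ε, hε, hpos⟩ : ∃ ε : ℝ, (ε = 1 ∨ ε = -1) ∧ ∀ x ∈ Ioo (0 : ℝ) 1, 0 < ε * f x := by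
    have hsign := fun x hx => mul_pos_of_forall_ne_zero (s := Ioo (0 : ℝ) 1) ordConnected_Ioo
      (hf.continuousOn.mono Ioo_zero_one_subset) hne hhalf (y := x) hx
    rcases lt_or_gt_of_ne (hne _ hhalf) with h | h
    · exact ⟨-1, Or.inr rfl, fun x hx => by nlinarith [neg_of_mul_pos_right (hsign x hx) h.le]⟩
    · exact ⟨1, Or.inl rfl, fun x hx => by
        rw [one_mul]; exact pos_of_mul_pos_right (hsign x hx) h.le⟩
  have hεε : ε * ε = 1 := by rcases hε with rfl | rfl <;> norm_num
  have hεabs : |ε| = 1 := by rcases hε with rfl | rfl <;> norm_num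
  obtain ⟨F, hFs, hFd, hFd', hFm, hF, hFt⟩ := exists_timeFunction
    (g := fun x => ε * f x) (contDiffOn_const.mul hf) hpos
  -- In the time coordinate of `ε f` this is translation by `-1`: the flow of `f` for time `-ε`. It
  -- moves inwards, so it is defined on all of `(0, 1)`.
  set e := (F.trans (Homeomorph.addRight (-1 : ℝ)).toOpenPartialHomeomorph).trans F.symm with hedef
  have heapp : ∀ x, e x = F.symm (F x + -1) := fun x => rfl
  have hsrc : e.source = Ioo 0 1 := by
    ext x
    simp only [hedef, OpenPartialHomeomorph.trans_source, hFs, mem_inter_iff, mem_preimage]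
    refine ⟨fun hx => hx.1.1, fun hx => ⟨⟨hx, mem_univ _⟩, hFt x hx ?_⟩⟩
    change F x + -1 ≤ F x
    linarith
  have hmem : ∀ x ∈ Ioo (0 : ℝ) 1, e x ∈ Ioo (0 : ℝ) 1 ∧ F (e x) = F x - 1 := by
    intro x hx
    have h1 : F x + -1 ∈ F.target := hFt x hx (show F x + -1 ≤ F x by linarith)
    refine ⟨hFs ▸ F.map_target h1, ?_⟩
    rw [heapp, F.right_inv h1, sub_eq_add_neg]
  have hs : e.source ⊆ Ioi 0 := fun x hx => (hsrc ▸ hx : x ∈ Ioo (0 : ℝ) 1).1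
  have ht : e.target ⊆ Ioi 0 := by
    intro y hy
    have h1 := e.map_target hy
    rw [hsrc] at h1
    rw [← e.right_inv hy]
    exact (hmem _ h1).1.1
  have he : ContDiffOn ℝ ∞ e e.source := by
    rw [hsrc]
    refine hFd'.comp (hFd.add contDiffOn_const) fun x hx => ?_
    exact hFt x hx (show F x + -1 ≤ F x by linarith)
  have he' : ContDiffOn ℝ ∞ e.symm e.target := by
    have h1 : e.symm = fun y => F.symm (F y + - -1) := rfl
    rw [h1]
    refine hFd'.comp ((hFd.mono fun y hy => ?_).add contDiffOn_const) fun y hy => ?_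
    · have h2 := e.map_target hy
      rw [hsrc] at h2
      rw [← e.right_inv hy]
      exact (hmem _ h2).1
    · have h2 := e.map_target hy
      rw [hsrc] at h2
      rw [← e.right_inv hy, (hmem _ h2).2, neg_neg, sub_add_cancel]
      exact F.map_source (by rw [hFs]; exact h2)
  set φ := radialHomeomorph 2 e hs ht he he' with hφ
  have hed : ∀ x ∈ Ioo (0 : ℝ) 1, HasDerivAt e (f (e x) * e x / (f x * x)) x := by
    intro x hx
    have hx' := hsrc.symm ▸ hx
    have h1 := ((he.contDiffAt (e.open_source.mem_nhds hx')).differentiableAt (by simp)).hasDerivAt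
    refine h1.congr_deriv ?_
    have h2 := (hF _ (hmem x hx).1).comp x h1
    have h3 := h2.unique (((hF x hx).sub_const 1).congr_of_eventuallyEq (by
      filter_upwards [isOpen_Ioo.mem_nhds hx] with w hw using (hmem w hw).2))
    have h4 := (hpos _ (hmem x hx).1).ne'
    have h5 := (hpos _ hx).ne'
    have h6 := (hmem x hx).1.1.ne'
    have h7 := hx.1.ne'
    have h8 : ε ≠ 0 := left_ne_zero_of_mul h5
    have h9 := hne x hx
    have h10 := hne _ (hmem x hx).1
    field_simp at h3 ⊢
    exact h3
  have hflow : IsFlowMap disc (radialField f) (-ε) φ := by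
    intro y hy
    have hy' : ‖y‖ ∈ Ioo (0 : ℝ) 1 := hsrc ▸ hy
    have hs' : ∀ s ∈ uIcc 0 (-ε), F ‖y‖ + ε * s ∈ F.target := by
      intro s hs
      refine hFt _ hy' (show F ‖y‖ + ε * s ≤ F ‖y‖ from ?_)
      rcases hε with rfl | rfl
      · rw [uIcc_of_ge (by norm_num)] at hs
        linarith [hs.2]
      · rw [uIcc_of_le (by norm_num)] at hs
        linarith [hs.1]
    have hρ : ∀ s ∈ uIcc 0 (-ε), F.symm (F ‖y‖ + ε * s) ∈ Ioo (0 : ℝ) 1 := fun s hs =>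
      hFs ▸ F.map_target (hs' s hs)
    have hyF : F.symm (F ‖y‖) = ‖y‖ := F.left_inv (by rw [hFs]; exact hy')
    refine ⟨fun s => (F.symm (F ‖y‖ + ε * s) / ‖y‖) • y, ?_, ?_, fun s hs => ?_, fun s hs => ?_⟩
    · simp only [mul_zero, add_zero]
      rw [hyF, div_self hy'.1.ne', one_smul]
    · simp only [hφ, radialHomeomorph_apply, heapp, mul_neg, hεε]
    · change _ ∈ Metric.ball (0 : E 2) 1
      rw [mem_ball_zero_iff, norm_div_norm_smul (hρ s hs).1 hy'.1]
      exact (hρ s hs).2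
    · set ρ := F.symm (F ‖y‖ + ε * s) with hρdef
      have h1 : HasDerivAt F.symm (((ε * f ρ * ρ)⁻¹)⁻¹) (F ‖y‖ + ε * s) :=
        F.hasDerivAt_symm (hs' s hs)
          (inv_ne_zero (mul_pos (hpos _ (hρ s hs)) (hρ s hs).1).ne') (hF _ (hρ s hs))
      have h2 : HasDerivAt (fun s => F ‖y‖ + ε * s) ε s := by
        simpa using ((hasDerivAt_id' s).const_mul ε).const_add (F ‖y‖)
      have h3 := ((h1.comp s h2).div_const ‖y‖).smul_const y
      refine (h3.congr_deriv ?_).hasDerivWithinAt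
      simp only [radialField]
      rw [← hρdef, norm_div_norm_smul (hρ s hs).1 hy'.1, smul_smul, inv_inv]
      congr 1
      linear_combination (f ρ * ρ / ‖y‖) * hεε
  -- Substituting `e' = f(e) e / (f(x) x)` turns the Jacobian determinant `e' e / x` into a quotient
  -- of values of `x² f`.
  have hlog : ∀ x ∈ Ioo (0 : ℝ) 1, Real.log (deriv e x * (e x / x)) =
      Real.log (e x ^ 2 * f (e x)) - Real.log (x ^ 2 * f x) := by
    intro x hx
    have h1 := hne x hx
    have h2 := hne _ (hmem x hx).1
    have h3 := hx.1.ne'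
    have h4 := (hmem x hx).1.1.ne'
    rw [← Real.log_div (by positivity) (by positivity), (hed x hx).deriv]
    congr 1
    field_simp
  refine ⟨φ, mem_flowPseudogroup radialHomeomorph_mem hflow, e,
    fun x => theta φ (x • axisVector) axisVector, F, fun x => (ε * f x * x)⁻¹, ?_, ?_, ?_, ?_, hFm,
    fun x hx => (hmem x hx).2, hed, fun _ _ => rfl, ?_, ?_⟩
  · intro y hy
    have hy' : ‖y‖ ∈ Ioo (0 : ℝ) 1 := hsrc ▸ hy
    change y ∈ Metric.ball (0 : E 2) 1
    rw [mem_ball_zero_iff]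
    exact hy'.2
  · intro x hx
    have hx' : x ∈ e.source := hsrc.symm ▸ hx
    refine ⟨smul_axisVector_mem_source hx', ?_⟩
    rw [hφ, radialHomeomorph_smul_axisVector hx']
    exact smul_axisVector_mem_disc (Ioo_zero_one_subset (hmem x hx).1)
  · intro x hx
    refine ⟨(hmem x hx).1.1, (hFm.lt_iff_lt (hmem x hx).1 hx).1 ?_⟩
    rw [(hmem x hx).2]
    linarith
  · intro x hx
    refine ⟨hF x hx, ?_⟩
    change |(ε * f x * x)⁻¹| = _
    rw [mul_assoc, mul_inv, abs_mul, abs_inv, hεabs, inv_one, one_mul]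
  · intro x hx
    refine (hasDerivAt_log_deriv_mul_div (hsrc.symm ▸ hx)).congr_of_eventuallyEq ?_
    filter_upwards [isOpen_Ioo.mem_nhds hx] with w hw using (hlog w hw).symm
  · intro x hx p
    rw [hφ, lift_radialHomeomorph_axis (hsrc.symm ▸ hx), (hed x hx).deriv]

/-- Only one contracting flow map and its iterates are needed. They bring `w = log |x² f|` to `-∞`,
whereas a primitive `G` would force `w` to converge along an orbit. -/
theorem chernLosikClass_radialField_ne_zero (hf : ContDiffOn ℝ ∞ f (Ioo (-1) 1))
    (hne : ∀ x ∈ Ioo (0 : ℝ) 1, f x ≠ 0) (h0 : f 0 = 0) :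
    chernLosikClass disc (radialField f) ≠ 0 := by
  intro hzero
  obtain ⟨G, hGd, hG⟩ := exists_primitive_of_chernLosikClass_eq_zero
    (U := disc) (convex_ball (0 : E 2) 1) hzero
  obtain ⟨φ, hφ, h, θ, F, F', hφs, hφx, hh, hF, hFm, hFh, hhd, hθ, hΛ, hlift⟩ :=
    exists_contraction hf hne
  have hh1 : ∀ x ∈ Ioo (0 : ℝ) 1, h x ∈ Ioo (0 : ℝ) 1 := fun x hx =>
    ⟨(hh x hx).1, (hh x hx).2.trans hx.2⟩
  set D : ℝ → ℝ := fun x => 2 * f x + deriv f x * x with hD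
  set w : ℝ → ℝ := fun x => Real.log (x ^ 2 * f x) with hw
  have hu : ∀ x ∈ Ioo (0 : ℝ) 1, f x * x ≠ 0 := fun x hx => mul_ne_zero (hne x hx) hx.1.ne'
  have hwd : ∀ x ∈ Ioo (0 : ℝ) 1, HasDerivAt w (D x / (f x * x)) x := fun x hx =>
    hasDerivAt_log_sq_mul hf hx (hne x hx)
  have hθD : ∀ x ∈ Ioo (0 : ℝ) 1, θ x = (D (h x) - D x) / (f x * x) := by
    intro x hx
    have h1 := (hΛ x hx).unique (((hwd _ (hh1 x hx)).comp x (hhd x hx)).sub (hwd x hx))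
    rw [h1, sub_div, div_mul_div_cancel₀ (hu _ (hh1 x hx))]
  -- The differential of `G ∘ lift φ - G` is `-theta φ`, which on the plane is `-d(w ∘ h - w)`; so
  -- the sum has zero differential on a convex set.
  obtain ⟨c, hc⟩ : ∃ c : ℝ, ∀ x ∈ Ioo (0 : ℝ) 1, ∀ p : ℝ,
      G (lift φ (axis (x, p))) - G (axis (x, p)) + (w (h x) - w x) = c := by
    have hder : ∀ q ∈ Ioo (0 : ℝ) 1 ×ˢ (univ : Set ℝ), HasFDerivWithinAt
        (fun q : ℝ × ℝ => G (lift φ (axis q)) - G (axis q) + (w (h q.1) - w q.1))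
        (0 : ℝ × ℝ →L[ℝ] ℝ) (Ioo (0 : ℝ) 1 ×ˢ (univ : Set ℝ)) q := by
      rintro ⟨x, p⟩ ⟨hx, -⟩
      have h1 := (hG φ hφ hφs (axis (x, p)) (hφx x hx).1 (hφx x hx).2).comp (x, p) axis.hasFDerivAt
      have h2 := (hΛ x hx).comp_hasFDerivAt (x, p) (hasFDerivAt_fst (𝕜 := ℝ) (p := (x, p)))
      refine ((h1.add h2).congr_fderiv ?_).hasFDerivWithinAt
      ext
      · simp [axis_apply, hθ x hx]
      · simp [axis_apply]
    have hconv : Convex ℝ (Ioo (0 : ℝ) 1 ×ˢ (univ : Set ℝ)) := (convex_Ioo _ _).prod convex_univ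
    have hhalf : ((1 / 2 : ℝ), (0 : ℝ)) ∈ Ioo (0 : ℝ) 1 ×ˢ (univ : Set ℝ) := by norm_num
    refine ⟨G (lift φ (axis (1 / 2, 0))) - G (axis (1 / 2, 0)) + (w (h (1 / 2)) - w (1 / 2)),
      fun x hx p => ?_⟩
    have h3 := hconv.norm_image_sub_le_of_norm_hasFDerivWithin_le hder (C := 0) (by simp) hhalf
      (show (x, p) ∈ _ from ⟨hx, mem_univ _⟩)
    rwa [zero_mul, norm_le_zero_iff, sub_eq_zero] at h3
  set x : ℕ → ℝ := fun n => h^[n] (1 / 2) with hxdef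
  have hxs : ∀ n, x (n + 1) = h (x n) := fun n => Function.iterate_succ_apply' h n _
  have hx : ∀ n, x n ∈ Ioo (0 : ℝ) 1 := by
    intro n
    induction n with
    | zero => norm_num [hxdef]
    | succ n ih => rw [hxs]; exact hh1 _ ih
  have hFx : ∀ n, F (x n) = F (x 0) - n := by
    intro n
    induction n with
    | zero => simp
    | succ n ih =>
      rw [hxs, hFh _ (hx n), ih]
      push_cast
      ring
  have hxlim : Filter.Tendsto x Filter.atTop (𝓝[>] 0) := by
    refine (nhdsGT_basis (0 : ℝ)).tendsto_right_iff.2 fun δ hδ => ?_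
    -- The truncation keeps the threshold in `(0, 1)`, where `F` is strictly increasing and can be
    -- compared with `F (x n) = F (x 0) - n`.
    set δ' := min δ (1 / 2) with hδ'
    have hδ1 : δ' ∈ Ioo (0 : ℝ) 1 :=
      ⟨lt_min hδ (by norm_num), (min_le_right _ _).trans_lt (by norm_num)⟩
    filter_upwards [(tendsto_natCast_atTop_atTop (R := ℝ)).eventually_gt_atTop (F (x 0) - F δ')]
      with n hn
    refine ⟨(hx n).1, ((hFm.lt_iff_lt (hx n) hδ1).1 ?_).trans_le (min_le_left _ _)⟩
    rw [hFx]
    linarith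
  have hDt : Filter.Tendsto D (𝓝[>] 0) (𝓝 0) :=
    (tendsto_radialDivergence hf h0).mono_left nhdsWithin_le_nhds
  -- The lift preserves `x f p - D`. Its value is taken to be `-D (x N)`, so that the covector is
  -- `0` at step `n = N`.
  have hiter : ∀ N n : ℕ, G (axis (x n, (D (x n) - D (x N)) / (f (x n) * x n))) + w (x n) =
      G (axis (x 0, (D (x 0) - D (x N)) / (f (x 0) * x 0))) + w (x 0) + n * c := by
    intro N n
    induction n with
    | zero => simp
    | succ n ih =>
      have h1 := hc _ (hx n) ((D (x n) - D (x N)) / (f (x n) * x n))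
      have h2 : (θ (x n) + (D (x n) - D (x N)) / (f (x n) * x n)) /
          (f (h (x n)) * h (x n) / (f (x n) * x n)) =
            (D (h (x n)) - D (x N)) / (f (h (x n)) * h (x n)) := by
        have h3 := hu _ (hx n)
        rw [hθD _ (hx n), ← add_div, div_div_div_cancel_right₀ h3]
        ring
      rw [hlift _ (hx n), h2] at h1
      rw [hxs]
      push_cast
      linarith
  have hlim : ∃ l : ℝ, Filter.Tendsto (fun N : ℕ => w (x N) - N * c) Filter.atTop (𝓝 l) := by
    have h1 : ∀ N : ℕ, w (x N) - N * c =
        G (axis (x 0, (D (x 0) - D (x N)) / (f (x 0) * x 0))) + w (x 0) - G (axis (x N, 0)) := by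
      intro N
      have := hiter N N
      rw [sub_self, zero_div] at this
      linarith
    simp only [h1]
    have ht1 : Filter.Tendsto (fun N => G (axis (x 0, (D (x 0) - D (x N)) / (f (x 0) * x 0))))
        Filter.atTop (𝓝 (G (axis (x 0, (D (x 0) - 0) / (f (x 0) * x 0))))) :=
      (((hGd _ (axis_mem (Ioo_zero_one_subset (hx 0)) _)).continuousAt.comp
        axis.continuous.continuousAt).tendsto).comp
          (tendsto_const_nhds.prodMk_nhds
            (((hDt.comp hxlim).const_sub _).div_const _))
    have ht2 : Filter.Tendsto (fun N => G (axis (x N, 0))) Filter.atTop (𝓝 (G (axis (0, 0)))) :=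
      (((hGd _ (axis_mem (by simp) 0)).continuousAt.comp
        axis.continuous.continuousAt).tendsto).comp
          ((hxlim.mono_right nhdsWithin_le_nhds).prodMk_nhds tendsto_const_nhds)
    exact ⟨_, (ht1.add_const _).sub ht2⟩
  -- Cauchy's mean value theorem against the time function: `F` changes by exactly `1` in each step
  -- and `|w' / F'| = |D|`, so an increment of `w` is `|D ξ|` in absolute value with `0 < ξ < x N`.
  have hincr : Filter.Tendsto (fun N => w (x (N + 1)) - w (x N)) Filter.atTop (𝓝 0) := by
    have h1 : ∀ N, ∃ ξ ∈ Ioo 0 (x N), |w (x (N + 1)) - w (x N)| = |D ξ| := by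
      intro N
      rw [hxs]
      have hN := hx N
      have hsub : Icc (h (x N)) (x N) ⊆ Ioo 0 1 := fun y hy =>
        ⟨(hh _ hN).1.trans_le hy.1, hy.2.trans_lt hN.2⟩
      obtain ⟨ξ, hξ, hξ'⟩ := exists_ratio_hasDerivAt_eq_ratio_slope w (fun y => D y / (f y * y))
        (hh _ hN).2 (fun y hy => (hwd y (hsub hy)).continuousAt.continuousWithinAt)
        (fun y hy => hwd y (hsub (Ioo_subset_Icc_self hy))) F F'
        (fun y hy => (hF y (hsub hy)).1.continuousAt.continuousWithinAt)
        (fun y hy => (hF y (hsub (Ioo_subset_Icc_self hy))).1)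
      have hξ1 := hsub (Ioo_subset_Icc_self hξ)
      refine ⟨ξ, ⟨hξ1.1, hξ.2⟩, ?_⟩
      rw [hFh _ hN, sub_sub_cancel, one_mul] at hξ'
      have h2 := congrArg abs hξ'
      rw [abs_mul, (hF ξ hξ1).2, div_eq_mul_inv, abs_mul, abs_sub_comm] at h2
      exact (mul_right_cancel₀ (abs_ne_zero.2 (inv_ne_zero (hu ξ hξ1))) h2).symm
    choose ξ hξ hξ' using h1
    have hξlim : Filter.Tendsto ξ Filter.atTop (𝓝[>] 0) :=
      tendsto_nhdsWithin_iff.2 ⟨squeeze_zero (fun N => (hξ N).1.le) (fun N => (hξ N).2.le)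
        (hxlim.mono_right nhdsWithin_le_nhds), Filter.Eventually.of_forall fun N => (hξ N).1⟩
    refine (tendsto_zero_iff_abs_tendsto_zero _).2 ?_
    have h3 := (hDt.comp hξlim).abs
    rw [abs_zero] at h3
    exact h3.congr fun N => (hξ' N).symm
  obtain ⟨l, hl⟩ := hlim
  -- The increments of the convergent sequence `w (x N) - N c` tend both to `0` and to `-c`.
  have hc0 : c = 0 := by
    have h1 := (hl.comp (Filter.tendsto_add_atTop_nat 1)).sub hl
    have h2 := hincr.sub_const c
    have h3 := tendsto_nhds_unique (h1.congr fun N => by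
      change w (x (N + 1)) - ((N + 1 : ℕ) : ℝ) * c - (w (x N) - N * c) =
        w (x (N + 1)) - w (x N) - c
      push_cast
      ring) h2
    linarith
  subst hc0
  simp only [mul_zero, sub_zero] at hl
  exact not_tendsto_nhds_of_tendsto_atBot ((tendsto_log_sq_mul hf hne).comp hxlim) l hl

end Contraction

end CL

end

theorem mainTheorem1 (f : ℝ → ℝ) (hf : ContDiffOn ℝ ∞ f (Ioo (-1) 1))
    (heven : ∀ x ∈ Ioo (-1 : ℝ) 1, f (-x) = f x) (hne : ∀ x ∈ Ioo (0 : ℝ) 1, f x ≠ 0) :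
    (CL.chernLosikClass CL.disc (CL.radialField f) ≠ 0 ↔ f 0 = 0) ∧
    (f 0 ≠ 0 → ∀ r₀ ∈ Ioo (0 : ℝ) 1, ∃ G₀ : CL.E 2 → ℝ,
      ContDiffOn ℝ ∞ G₀ CL.disc ∧
      (∀ y ∈ CL.disc, y ≠ 0 → G₀ y =
        -∫ ρ in r₀..‖y‖, (2 * f ρ + deriv f ρ * ρ - 2 * f 0) / (f ρ * ρ)) ∧
      CL.IsSolution CL.disc (CL.radialField f) (2 * f 0) (fun z => G₀ z.1)) ∧
    (f 0 = 0 → ¬ ∃ (R : ℝ) (G : CL.BModel 2 → ℝ),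
      CL.IsSolution CL.disc (CL.radialField f) R G) := by
  -- By parity `f` has no zero on the negative side either.
  have hne' : f 0 ≠ 0 → ∀ x ∈ Ioo (-1 : ℝ) 1, f x ≠ 0 := by
    intro h0 x hx
    rcases lt_trichotomy x 0 with h | rfl | h
    · rw [← heven x hx]
      exact hne _ ⟨by linarith, by linarith [hx.1]⟩
    · exact h0
    · exact hne x ⟨h, hx.2⟩
  refine ⟨⟨fun h => ?_, CL.chernLosikClass_radialField_ne_zero hf hne⟩, fun h0 r₀ hr => ?_, ?_⟩
  · by_contra h0
    exact h (CL.chernLosikClass_radialField_eq_zero hf heven (hne' h0))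
  · obtain ⟨h1, h2⟩ := CL.isSolution_radialField hf heven (hne' h0)
      (CL.Ioo_zero_one_subset hr) (fun _ => rfl)
    exact ⟨_, h1, fun _ _ _ => rfl, h2⟩
  · rintro h0 ⟨R, G, hG⟩
    exact CL.not_isSolution_radialField hf heven hne h0 R G hG
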